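/- **Proposition (Exact scaling of the Trotter number $r$).** Consider $N\ge 2$ qubits labelled by $\Lambda=\{1,\dots,N\}$ and a $k$-local, $g$-extensive Hamiltonian with positive-semidefinite terms, $$H=\sum_{X\subset\Lambda,\ |X|\le k}h_X,\qquad h_X\ge 0 \text{ acting on the sites of } X,\qquad \sum_{X\ni i}\|h_X\|\le g\quad\text{for all } i\in\Lambda .$$ Let $H=\sum_{\gamma=1}^{\Gamma}H_\gamma$ with $H_\gamma=\sum_X h_X^\gamma$, where $h_X^\gamma\ge0$ acts on $X$, $h_X=\sum_\gamma h_X^\gamma$, and for each $\gamma$ the operators $\{h_X^\gamma\}_X$ commute pairwise. Let $$T_p(t)=\prod_{v=1}^{c_p\Gamma}e^{-iH_{\gamma_v}\alpha_v t},\qquad |\alpha_v|\le 1,$$ be a product formula of order $p\ge 1$, i.e. $T_p(t)=e^{-iHt}+O(t^{p+1})$ as $t\to0$. Let $\Pi_{\le\Delta}=\sum_{n:E_n\le\Delta}|E_n\rangle\langle E_n|$ be the spectral projection of $H=\sum_n E_n|E_n\rangle\langle E_n|$ onto energies at most $\Delta\ge 0$, let $t\ge0$ and $\varepsilon\in(0,1)$,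 and put $$r_0=gt\left(\frac{\Delta t+gt\log(N/\varepsilon)}{\varepsilon}\right)^{1/p}.$$ Suppose that $gt$ and $1/\varepsilon$ are at most polynomial in $N$: $gt\le K N^a$ and $1/\varepsilon\le K N^a$. 1. For every $\Gamma_0$ there is a constant $C>0$, depending only on $p,k,c_p,K,a,\Gamma_0$, such that in all such situations with $\Gamma\le\Gamma_0$ there is an integer $r\ge1$ with $r\le\max\{1,\,C\,r_0\}$ and $$\big\|\big(e^{-iHt}-T_p(t/r)^r\big)\Pi_{\le\Delta}\big\|\le\varepsilon .$$ 2. There is a constant $C>0$, depending only on $p,k,c_p,K,a$ (and not on $\Gamma$), such that in all such situations, with $\Gamma$ arbitrary and each $H_\gamma$ occurring in exactly $c_p$ of the $c_p\Gamma$ factors of $T_p$, there is an integer $r\ge1$ with $r\le\max\{1,\,C\,r_0\log(N/\varepsilon)\}$ and $$\big\|\big(e^{-iHt}-T_p(t/r)^r\big)\Pi_{\le\Delta}\big\|\le\varepsilon .$$ -/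

import Mathlib

open Filter Topology Asymptotics
open scoped Matrix.Norms.L2Operator ComplexOrder

/-- Operators on the Hilbert space of `N` qubits, as matrices in the computational basis
`Fin N → Fin 2`.  The norm `‖·‖` on them is the operator norm of `ℂ^(2^N)`. -/
abbrev QubitOp (N : ℕ) : Type := Matrix (Fin N → Fin 2) (Fin N → Fin 2) ℂ

/-- `A` acts on the sites of `X` only: `A = B ⊗ 1`, where `B` is an operator on the qubits in `X`
and `1` is the identity on the other qubits. -/
def ActsOn {N : ℕ} (A : QubitOp N) (X : Finset (Fin N)) : Prop :=
  ∃ B : Matrix (X → Fin 2) (X → Fin 2) ℂ, ∀ σ τ : Fin N → Fin 2,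
    A σ τ = if ∀ i, i ∉ X → σ i = τ i then B (fun i => σ i) (fun i => τ i) else 0

/-- A `k`-local, `g`-extensive family of positive-semidefinite interaction terms `h_X` on
`N` qubits. -/
structure LocalHamiltonian (N k : ℕ) (g : ℝ) where
  /-- The interaction terms `h_X`. -/
  term : Finset (Fin N) → QubitOp N
  actsOn : ∀ X, ActsOn (term X) X
  posSemidef : ∀ X, (term X).PosSemidef
  eq_zero_of_card : ∀ X : Finset (Fin N), k < X.card → term X = 0
  extensive : ∀ i : Fin N, ∑ X with i ∈ X, ‖term X‖ ≤ g

namespace LocalHamiltonian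

/-- The Hamiltonian `H = ∑_X h_X`. -/
def total {N k : ℕ} {g : ℝ} (h : LocalHamiltonian N k g) : QubitOp N := ∑ X, h.term X

theorem isHermitian_total {N k : ℕ} {g : ℝ} (h : LocalHamiltonian N k g) :
    h.total.IsHermitian := by
  unfold total Matrix.IsHermitian
  rw [Matrix.conjTranspose_sum]
  exact Finset.sum_congr rfl fun X _ => (h.posSemidef X).isHermitian

/-- A partition of the Hamiltonian into `Γ` groups: `h_X = ∑_γ h_X^γ`, with `h_X^γ ≥ 0` acting on
`X`, and with mutually commuting terms within each group. -/
structure Partition {N k : ℕ} {g : ℝ} (h : LocalHamiltonian N k g) (Γ : ℕ) where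
  /-- The terms `h_X^γ`. -/
  part : Fin Γ → Finset (Fin N) → QubitOp N
  actsOn : ∀ γ X, ActsOn (part γ X) X
  posSemidef : ∀ γ X, (part γ X).PosSemidef
  commute : ∀ γ X Y, Commute (part γ X) (part γ Y)
  sum_part : ∀ X, ∑ γ, part γ X = h.term X

/-- The group Hamiltonian `H_γ = ∑_X h_X^γ`. -/
def Partition.group {N k : ℕ} {g : ℝ} {h : LocalHamiltonian N k g} {Γ : ℕ}
    (D : h.Partition Γ) (γ : Fin Γ) : QubitOp N := ∑ X, D.part γ X

end LocalHamiltonian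

/-- The time evolution operator `e^{-iHt}`. -/
noncomputable def evolution {N : ℕ} (H : QubitOp N) (t : ℝ) : QubitOp N :=
  NormedSpace.exp ((-(Complex.I * (t : ℂ))) • H)

/-- The spectral projection `Π_{≤ Δ} = ∑_{n : E_n ≤ Δ} |E_n⟩⟨E_n|` of a Hermitian operator,
written as `U D U†`, where the columns of `U` are the eigenvectors `|E_n⟩` and `D` is the diagonal
matrix of the indicator of `E_n ≤ Δ`. -/
noncomputable def lowEnergyProj {N : ℕ} {H : QubitOp N} (hH : H.IsHermitian) (Δ : ℝ) : QubitOp N :=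
  (hH.eigenvectorUnitary : QubitOp N) *
    Matrix.diagonal (fun n => if hH.eigenvalues n ≤ Δ then (1 : ℂ) else 0) *
    star (hH.eigenvectorUnitary : QubitOp N)

/-- A `p`-th order product formula for a partition into `Γ` groups, made of `c * Γ` exponentials
`e^{-i H_{γ_v} α_v t}` with `|α_v| ≤ 1`. -/
structure ProductFormula {N k : ℕ} {g : ℝ} {h : LocalHamiltonian N k g} {Γ : ℕ}
    (D : h.Partition Γ) (c p : ℕ) where
  /-- The group `γ_v` used in the `v`-th factor. -/
  idx : Fin (c * Γ) → Fin Γ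
  /-- The coefficient `α_v` of the `v`-th factor. -/
  coeff : Fin (c * Γ) → ℝ
  abs_coeff_le_one : ∀ v, |coeff v| ≤ 1
  order_condition :
    (fun t : ℝ =>
      (List.ofFn fun v => evolution (D.group (idx v)) (coeff v * t)).prod - evolution h.total t)
      =O[𝓝 0] (fun t : ℝ => t ^ (p + 1))

namespace ProductFormula

/-- The unitary `T_p(t) = ∏_v e^{-i H_{γ_v} α_v t}`. -/
noncomputable def step {N k : ℕ} {g : ℝ} {h : LocalHamiltonian N k g} {Γ : ℕ}
    {D : h.Partition Γ} {c p : ℕ} (T : ProductFormula D c p) (t : ℝ) : QubitOp N :=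
  (List.ofFn fun v => evolution (D.group (T.idx v)) (T.coeff v * t)).prod

/-- Each group Hamiltonian appears in exactly `c` of the `c * Γ` factors. -/
def Balanced {N k : ℕ} {g : ℝ} {h : LocalHamiltonian N k g} {Γ : ℕ}
    {D : h.Partition Γ} {c p : ℕ} (T : ProductFormula D c p) : Prop :=
  ∀ γ : Fin Γ, (Finset.univ.filter fun v => T.idx v = γ).card = c

/-- The error `‖(e^{-iHt} - T_p(t/r)^r) Π_{≤ Δ}‖` of `r` Trotter steps on low-energy states. -/
noncomputable def lowEnergyError {N k : ℕ} {g : ℝ} {h : LocalHamiltonian N k g} {Γ : ℕ}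
    {D : h.Partition Γ} {c p : ℕ} (T : ProductFormula D c p) (Δ t : ℝ) (r : ℕ) : ℝ :=
  ‖(evolution h.total t - T.step (t / r) ^ r) * lowEnergyProj h.isHermitian_total Δ‖

end ProductFormula

/-- The scale `gt ((Δt + gt log(N/ε)) / ε)^{1/p}`. -/
noncomputable def trotterScale (p N : ℕ) (g t Δ ε : ℝ) : ℝ :=
  g * t * ((Δ * t + g * t * Real.log (N / ε)) / ε) ^ (1 / (p : ℝ))

/-!
The proof compares one Trotter step `T(s)` with `U(s) = e^{-iHs}` through its *effective generator*
`G`, defined by `T' = -i G T`: the sum of the `α_v H_{γ_v}`, each conjugated by the factors to its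
left. Since `U` commutes with the spectral projection `Π`, the error of `r` steps of length
`s = t / r` is at most `r ‖(U(s) - T(s)) Π‖ ≤ t sup_{τ < s} ‖(G(τ) - H) Π‖`
(`norm_pow_sub_pow_mul_le`, `norm_exp_sub_expProd_mul_le`). The order condition says that `G(z) - H`
vanishes to order `p` at `z = 0` (`effGen_sub_isBigO`), and `G` is entire. By the Schwarz lemma
(`norm_effGen_sub_mul_le`) it therefore suffices to show that `‖G(z) Π‖ ≤ C (Δ + g)` for complex
`z` with `|z| < c₀ / g`, uniformly in `N` and in the number of groups. This gives the error bound
`C t (Δ + g) (C' g t / r) ^ p`, from which `r` is chosen.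

The bound on `G(z) Π` (`PieceSystem.norm_effGen_apply_sq_le`) rests on positivity of the terms.
Write every term as `h = c† c`. Expanding the conjugations by `e^{± i α z H_γ}` into iterated small
commutators (`tendsto_iterate_commutator`), `G(z)` becomes a limit of sums of *atoms* `c_x† u c_y`,
where `u` is local and the total size of the atoms is controlled as in a cluster expansion: each
atom carries a weight exponential in the number of its sites, and a commutator is paid for by a
small decrease of these weights (`PieceSystem.Majorized.add_commutator`). For such a sum
`A = ∑ a`, the square `‖A ψ‖²` is a double sum over pairs of atoms
(`PieceSystem.Majorized.norm_apply_sq_le`). In a pair with disjoint supports the roots commute past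
the other atom, and the Cauchy–Schwarz inequality bounds it by products `h_x h_y` of terms with
disjoint supports. These are positive and belong to `H²`, so together they are bounded by
`‖H ψ‖²` up to a multiple of `g ⟨ψ, H ψ⟩` (`PieceSystem.sum_disjoint_le`). Overlapping pairs are
few, and contribute at most a multiple of `g ⟨ψ, H ψ⟩`. For `ψ` in the range of `Π` both quantities
are controlled by `Δ`.

The constants depend on the product formula only through the number of factors that belong to the
same group: at most `c Γ₀` in the first part and exactly `c` in the second, which is why the second
constant does not depend on `Γ`.
-/

/-! ### Families of local positive pieces -/

/-- A finite family of positive operators `h_p = c_p† c_p` on a Hilbert space, each attached to a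
set `supp p` of at most `k` sites; the roots `c_p` of pieces with disjoint supports commute, also
with each other's adjoints.  The number `wt p` is an upper bound for `‖h_p‖`. -/
structure PieceSystem (S P : Type) [DecidableEq S] (𝓗 : Type) [NormedAddCommGroup 𝓗]
    [InnerProductSpace ℂ 𝓗] [CompleteSpace 𝓗] (k : ℕ) where
  /-- The sites on which a piece acts. -/
  supp : P → Finset S
  /-- The operator `c_p` with `h_p = c_p† c_p`. -/
  root : P → 𝓗 →L[ℂ] 𝓗
  /-- An upper bound for the norm of `h_p`. -/
  wt : P → ℝ
  card_supp_le : ∀ p, (supp p).card ≤ k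
  norm_root_sq_le : ∀ p, ‖root p‖ ^ 2 ≤ wt p
  commute_root : ∀ p q, Disjoint (supp p) (supp q) → Commute (root p) (root q)
  commute_star_root : ∀ p q, Disjoint (supp p) (supp q) → Commute (root p) (star (root q))

namespace PieceSystem

variable {S P : Type} [DecidableEq S] {𝓗 : Type} [NormedAddCommGroup 𝓗]
  [InnerProductSpace ℂ 𝓗] [CompleteSpace 𝓗] {k : ℕ} (𝒮 : PieceSystem S P 𝓗 k)

/-- The positive operator `h_p = c_p† c_p`. -/
noncomputable def piece (p : P) : 𝓗 →L[ℂ] 𝓗 := star (𝒮.root p) * 𝒮.root p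

/-- The star algebra generated by the roots of the pieces supported in `Z`. -/
noncomputable def localAlg (Z : Finset S) : StarSubalgebra ℂ (𝓗 →L[ℂ] 𝓗) :=
  StarAlgebra.adjoin ℂ (𝒮.root '' {p | 𝒮.supp p ⊆ Z})

theorem wt_nonneg (p : P) : 0 ≤ 𝒮.wt p := (sq_nonneg _).trans (𝒮.norm_root_sq_le p)

theorem localAlg_mono {Z Z' : Finset S} (h : Z ⊆ Z') : 𝒮.localAlg Z ≤ 𝒮.localAlg Z' :=
  StarAlgebra.adjoin_mono (Set.image_mono fun _ hp => Finset.Subset.trans hp h)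

theorem root_mem_localAlg {p : P} {Z : Finset S} (h : 𝒮.supp p ⊆ Z) :
    𝒮.root p ∈ 𝒮.localAlg Z :=
  StarAlgebra.subset_adjoin ℂ _ ⟨p, h, rfl⟩

theorem piece_mem_localAlg (p : P) : 𝒮.piece p ∈ 𝒮.localAlg (𝒮.supp p) :=
  mul_mem (star_mem (𝒮.root_mem_localAlg subset_rfl)) (𝒮.root_mem_localAlg subset_rfl)

/-- Locality: operators built from pieces on disjoint sets of sites commute. -/
theorem commute_of_mem_localAlg {Z Z' : Finset S} (hZ : Disjoint Z Z') {A B : 𝓗 →L[ℂ] 𝓗}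
    (hA : A ∈ 𝒮.localAlg Z) (hB : B ∈ 𝒮.localAlg Z') : Commute A B := by
  have h1 : 𝒮.localAlg Z ≤ StarSubalgebra.centralizer ℂ (𝒮.root '' {p | 𝒮.supp p ⊆ Z'}) := by
    refine StarAlgebra.adjoin_le ?_
    rintro _ ⟨p, hp, rfl⟩
    rw [SetLike.mem_coe, StarSubalgebra.mem_centralizer_iff]
    rintro _ ⟨q, hq, rfl⟩
    have hd : Disjoint (𝒮.supp p) (𝒮.supp q) := hZ.mono hp hq
    exact ⟨(𝒮.commute_root p q hd).symm.eq, (𝒮.commute_star_root p q hd).symm.eq⟩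
  have h2 : 𝒮.localAlg Z' ≤ StarSubalgebra.centralizer ℂ (𝒮.localAlg Z : Set (𝓗 →L[ℂ] 𝓗)) := by
    refine StarAlgebra.adjoin_le fun b hb => ?_
    rw [SetLike.mem_coe, StarSubalgebra.mem_centralizer_iff]
    intro a ha
    have key : ∀ a ∈ 𝒮.localAlg Z, a * b = b * a := fun a ha =>
      ((StarSubalgebra.mem_centralizer_iff ℂ).1 (h1 ha) b hb).1.symm
    exact ⟨key a ha, key _ (star_mem ha)⟩
  exact ((StarSubalgebra.mem_centralizer_iff ℂ).1 (h2 hB) A hA).1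

/-- An operator of the form `c_x† u c_y`, where `c_x` and `c_y` are roots of pieces and `u` is
local, together with numerical bounds.  The numbers `lw` and `rw` control the operator from the two
sides by `lw • h_x` and `rw • h_y`, and `size` bounds its norm. -/
structure Atom where
  /-- The label `x` of the left root. -/
  left : P
  /-- The label `y` of the right root. -/
  right : P
  /-- The middle factor `u`. -/
  core : 𝓗 →L[ℂ] 𝓗
  /-- A set of sites on which all three factors act. -/
  sites : Finset S
  /-- A bound for the norm of the operator. -/
  size : ℝ
  /-- The weight of the left piece. -/
  lw : ℝ
  /-- The weight of the right piece. -/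
  rw : ℝ
  left_subset : 𝒮.supp left ⊆ sites
  right_subset : 𝒮.supp right ⊆ sites
  core_mem : core ∈ 𝒮.localAlg sites
  lw_nonneg : 0 ≤ lw
  rw_nonneg : 0 ≤ rw
  norm_core_sq_le : ‖core‖ ^ 2 ≤ lw * rw
  wt_mul_lw_le : 𝒮.wt left * lw ≤ size
  wt_mul_rw_le : 𝒮.wt right * rw ≤ size

namespace Atom

variable {𝒮}

/-- The operator `c_x† u c_y`. -/
noncomputable def op (a : 𝒮.Atom) : 𝓗 →L[ℂ] 𝓗 := star (𝒮.root a.left) * a.core * 𝒮.root a.right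

theorem size_nonneg (a : 𝒮.Atom) : 0 ≤ a.size :=
  (mul_nonneg (𝒮.wt_nonneg _) a.lw_nonneg).trans a.wt_mul_lw_le

theorem op_mem (a : 𝒮.Atom) : a.op ∈ 𝒮.localAlg a.sites :=
  mul_mem (mul_mem (star_mem (𝒮.root_mem_localAlg a.left_subset)) a.core_mem)
    (𝒮.root_mem_localAlg a.right_subset)

/-- The atom `z h_p`. -/
noncomputable def single (z : ℂ) (p : P) : 𝒮.Atom where
  left := p
  right := p
  core := z • 1
  sites := 𝒮.supp p
  size := ‖z‖ * 𝒮.wt p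
  lw := ‖z‖
  rw := ‖z‖
  left_subset := subset_rfl
  right_subset := subset_rfl
  core_mem := SMulMemClass.smul_mem z (one_mem _)
  lw_nonneg := norm_nonneg _
  rw_nonneg := norm_nonneg _
  norm_core_sq_le := by
    rw [← sq]
    refine pow_le_pow_left₀ (norm_nonneg _) ?_ 2
    rw [norm_smul]
    exact mul_le_of_le_one_right (norm_nonneg _) ContinuousLinearMap.norm_id_le
  wt_mul_lw_le := (mul_comm _ _).le
  wt_mul_rw_le := (mul_comm _ _).le

theorem single_op (z : ℂ) (p : P) : (single z p : 𝒮.Atom).op = z • 𝒮.piece p := by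
  simp [single, op, piece]

/-- The atom `z h_p a`. -/
noncomputable def mulLeft (z : ℂ) (p : P) (a : 𝒮.Atom) : 𝒮.Atom where
  left := p
  right := a.right
  core := z • (𝒮.root p * star (𝒮.root a.left) * a.core)
  sites := a.sites ∪ 𝒮.supp p
  size := ‖z‖ * 𝒮.wt p * a.size
  lw := ‖z‖ * a.size
  rw := ‖z‖ * 𝒮.wt p * a.rw
  left_subset := Finset.subset_union_right
  right_subset := a.right_subset.trans Finset.subset_union_left
  core_mem := SMulMemClass.smul_mem z
    (mul_mem (mul_mem (𝒮.root_mem_localAlg Finset.subset_union_right)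
      (star_mem (𝒮.root_mem_localAlg (a.left_subset.trans Finset.subset_union_left))))
      (𝒮.localAlg_mono Finset.subset_union_left a.core_mem))
  lw_nonneg := mul_nonneg (norm_nonneg _) a.size_nonneg
  rw_nonneg := mul_nonneg (mul_nonneg (norm_nonneg _) (𝒮.wt_nonneg _)) a.rw_nonneg
  norm_core_sq_le := by
    have h1 : ‖z • (𝒮.root p * star (𝒮.root a.left) * a.core)‖
        ≤ ‖z‖ * (‖𝒮.root p‖ * ‖𝒮.root a.left‖ * ‖a.core‖) := by
      rw [norm_smul]
      gcongr
      refine (norm_mul_le _ _).trans ?_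
      gcongr
      refine (norm_mul_le _ _).trans ?_
      rw [norm_star]
    calc _ ≤ (‖z‖ * (‖𝒮.root p‖ * ‖𝒮.root a.left‖ * ‖a.core‖)) ^ 2 := by gcongr
      _ = ‖z‖ ^ 2 * ‖𝒮.root p‖ ^ 2 * (‖𝒮.root a.left‖ ^ 2 * ‖a.core‖ ^ 2) := by ring
      _ ≤ ‖z‖ ^ 2 * 𝒮.wt p * (𝒮.wt a.left * (a.lw * a.rw)) := by
        have := 𝒮.wt_nonneg
        gcongr
        · exact mul_nonneg (sq_nonneg _) (this _)
        · exact 𝒮.norm_root_sq_le _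
        · exact this _
        · exact 𝒮.norm_root_sq_le _
        · exact a.norm_core_sq_le
      _ = ‖z‖ ^ 2 * 𝒮.wt p * ((𝒮.wt a.left * a.lw) * a.rw) := by ring
      _ ≤ ‖z‖ ^ 2 * 𝒮.wt p * (a.size * a.rw) := by
        have h2 := 𝒮.wt_nonneg p
        have h3 := a.rw_nonneg
        gcongr
        exact a.wt_mul_lw_le
      _ = _ := by ring
  wt_mul_lw_le := le_of_eq (by ring)
  wt_mul_rw_le := by
    have h2 := 𝒮.wt_nonneg p
    calc _ = ‖z‖ * 𝒮.wt p * (𝒮.wt a.right * a.rw) := by ring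
      _ ≤ _ := by gcongr; exact a.wt_mul_rw_le

theorem mulLeft_op (z : ℂ) (p : P) (a : 𝒮.Atom) : (a.mulLeft z p).op = z • (𝒮.piece p * a.op) := by
  simp [mulLeft, op, piece, mul_assoc]

/-- The atom `z a h_p`. -/
noncomputable def mulRight (z : ℂ) (p : P) (a : 𝒮.Atom) : 𝒮.Atom where
  left := a.left
  right := p
  core := z • (a.core * 𝒮.root a.right * star (𝒮.root p))
  sites := a.sites ∪ 𝒮.supp p
  size := ‖z‖ * 𝒮.wt p * a.size
  lw := ‖z‖ * 𝒮.wt p * a.lw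
  rw := ‖z‖ * a.size
  left_subset := a.left_subset.trans Finset.subset_union_left
  right_subset := Finset.subset_union_right
  core_mem := SMulMemClass.smul_mem z
    (mul_mem (mul_mem (𝒮.localAlg_mono Finset.subset_union_left a.core_mem)
      (𝒮.root_mem_localAlg (a.right_subset.trans Finset.subset_union_left)))
      (star_mem (𝒮.root_mem_localAlg Finset.subset_union_right)))
  rw_nonneg := mul_nonneg (norm_nonneg _) a.size_nonneg
  lw_nonneg := mul_nonneg (mul_nonneg (norm_nonneg _) (𝒮.wt_nonneg _)) a.lw_nonneg
  norm_core_sq_le := by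
    have h1 : ‖z • (a.core * 𝒮.root a.right * star (𝒮.root p))‖
        ≤ ‖z‖ * (‖a.core‖ * ‖𝒮.root a.right‖ * ‖𝒮.root p‖) := by
      rw [norm_smul]
      gcongr
      refine (norm_mul_le _ _).trans ?_
      rw [norm_star]
      gcongr
      exact norm_mul_le _ _
    calc _ ≤ (‖z‖ * (‖a.core‖ * ‖𝒮.root a.right‖ * ‖𝒮.root p‖)) ^ 2 := by gcongr
      _ = ‖z‖ ^ 2 * ‖𝒮.root p‖ ^ 2 * (‖𝒮.root a.right‖ ^ 2 * ‖a.core‖ ^ 2) := by ring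
      _ ≤ ‖z‖ ^ 2 * 𝒮.wt p * (𝒮.wt a.right * (a.lw * a.rw)) := by
        have := 𝒮.wt_nonneg
        gcongr
        · exact mul_nonneg (sq_nonneg _) (this _)
        · exact 𝒮.norm_root_sq_le _
        · exact this _
        · exact 𝒮.norm_root_sq_le _
        · exact a.norm_core_sq_le
      _ = ‖z‖ ^ 2 * 𝒮.wt p * (a.lw * (𝒮.wt a.right * a.rw)) := by ring
      _ ≤ ‖z‖ ^ 2 * 𝒮.wt p * (a.lw * a.size) := by
        have h2 := 𝒮.wt_nonneg p
        have h3 := a.lw_nonneg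
        gcongr
        exact a.wt_mul_rw_le
      _ = _ := by ring
  wt_mul_rw_le := le_of_eq (by ring)
  wt_mul_lw_le := by
    have h2 := 𝒮.wt_nonneg p
    calc _ = ‖z‖ * 𝒮.wt p * (𝒮.wt a.left * a.lw) := by ring
      _ ≤ _ := by gcongr; exact a.wt_mul_lw_le

theorem mulRight_op (z : ℂ) (p : P) (a : 𝒮.Atom) :
    (a.mulRight z p).op = z • (a.op * 𝒮.piece p) := by
  simp [mulRight, op, piece, mul_assoc]

end Atom
end PieceSystem

/-! ### Site weights and majorized operators -/

/-- Lowering the weights `f` to `f'` leaves room for a factor that grows linearly with `Z`. -/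
theorem prod_mul_one_add_sum_le {S : Type} {f f' s : S → ℝ} {η : ℝ}
    (hη : 0 ≤ η) (hs : ∀ i, 0 ≤ s i) (hf' : ∀ i, 0 ≤ f' i) (hf3 : ∀ i, f i ≤ 3)
    (hstep : ∀ i, f' i + 3 * η * s i ≤ f i) (Z : Finset S) :
    (∏ i ∈ Z, f' i) * (1 + η * ∑ i ∈ Z, s i) ≤ ∏ i ∈ Z, f i := by
  classical
  induction Z using Finset.induction_on with
  | empty => simp
  | insert a Z ha ih =>
    rw [Finset.prod_insert ha, Finset.prod_insert ha, Finset.sum_insert ha]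
    have hpos : 0 ≤ ∏ i ∈ Z, f' i := Finset.prod_nonneg fun i _ => hf' i
    have hS : 0 ≤ ∑ i ∈ Z, s i := Finset.sum_nonneg fun i _ => hs i
    have h1 : 0 ≤ η * s a := mul_nonneg hη (hs a)
    have h2 : f' a ≤ 3 := by
      have := hstep a; have := hf3 a; nlinarith
    have h3 : f' a * (1 + η * s a) ≤ f a := by
      have := hstep a; nlinarith
    calc f' a * (∏ i ∈ Z, f' i) * (1 + η * (s a + ∑ i ∈ Z, s i))
        ≤ (f' a * (1 + η * s a)) * ((∏ i ∈ Z, f' i) * (1 + η * ∑ i ∈ Z, s i)) := by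
          have := mul_nonneg (mul_nonneg (hf' a) hpos)
            (mul_nonneg h1 (mul_nonneg hη hS))
          nlinarith
      _ ≤ f a * ∏ i ∈ Z, f i := by
          refine mul_le_mul h3 ih (mul_nonneg hpos (by positivity)) ?_
          exact (mul_nonneg (hf' a) (by positivity)).trans h3

theorem prod_union_le {S : Type} [DecidableEq S] {f : S → ℝ} (h1 : ∀ i, 1 ≤ f i)
    (h3 : ∀ i, f i ≤ 3) {k : ℕ} {X : Finset S} (hX : X.card ≤ k) (Z : Finset S) :
    ∏ i ∈ Z ∪ X, f i ≤ 3 ^ k * ∏ i ∈ Z, f i := by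
  have h0 : ∀ i, 0 ≤ f i := fun i => zero_le_one.trans (h1 i)
  rw [← Finset.union_sdiff_self_eq_union, Finset.prod_union Finset.disjoint_sdiff, mul_comm]
  gcongr
  · exact Finset.prod_nonneg fun i _ => h0 i
  calc ∏ i ∈ X \ Z, f i ≤ ∏ _i ∈ X \ Z, (3 : ℝ) :=
        Finset.prod_le_prod (fun i _ => h0 i) fun i _ => h3 i
    _ = 3 ^ (X \ Z).card := by simp
    _ ≤ 3 ^ k := pow_le_pow_right₀ (by norm_num)
        ((Finset.card_le_card Finset.sdiff_subset).trans hX)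

namespace PieceSystem

set_option linter.unusedSectionVars false

variable {S P : Type} [DecidableEq S] [Fintype P] [DecidableEq P]
  {𝓗 : Type} [NormedAddCommGroup 𝓗] [InnerProductSpace ℂ 𝓗] [CompleteSpace 𝓗] {k : ℕ}
  (𝒮 : PieceSystem S P 𝓗 k)

/-- The strength at site `i` of the operator `∑ d_p h_p`, that is, the total norm of its terms
acting on `i`. -/
noncomputable def strength (d : P → ℂ) (i : S) : ℝ :=
  ∑ p, if i ∈ 𝒮.supp p then ‖d p‖ * 𝒮.wt p else 0

/-- The operator `∑ d_p h_p`. -/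
noncomputable def combo (d : P → ℂ) : 𝓗 →L[ℂ] 𝓗 := ∑ p, d p • 𝒮.piece p

/-- `A` is a finite sum of atoms such that, counting every atom with the weight
`∏ f i` over its sites, the atoms acting on site `i` have total size at most `ν i`, and
the left and right weights resting on the piece `p` add up to at most `ρ p` each. -/
def Majorized (f ν : S → ℝ) (ρ : P → ℝ) (A : 𝓗 →L[ℂ] 𝓗) : Prop :=
  ∃ (ι : Type) (_ : Fintype ι) (a : ι → 𝒮.Atom), A = ∑ j, (a j).op ∧
    (∀ i, ∑ j, (if i ∈ (a j).sites then (a j).size * ∏ l ∈ (a j).sites, f l else 0) ≤ ν i) ∧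
    (∀ p, ∑ j, (if (a j).left = p then (a j).lw * ∏ l ∈ (a j).sites, f l else 0) ≤ ρ p) ∧
    (∀ p, ∑ j, (if (a j).right = p then (a j).rw * ∏ l ∈ (a j).sites, f l else 0) ≤ ρ p)

variable {𝒮}

theorem strength_nonneg (d : P → ℂ) (i : S) : 0 ≤ 𝒮.strength d i :=
  Finset.sum_nonneg fun p _ => by
    split_ifs
    · exact mul_nonneg (norm_nonneg _) (𝒮.wt_nonneg p)
    · rfl

theorem strength_smul (z : ℂ) (d : P → ℂ) (i : S) :
    𝒮.strength (z • d) i = ‖z‖ * 𝒮.strength d i := by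
  simp only [strength, Finset.mul_sum, Pi.smul_apply, smul_eq_mul, norm_mul, mul_ite, mul_zero,
    mul_assoc]

theorem combo_smul (z : ℂ) (d : P → ℂ) : 𝒮.combo (z • d) = z • 𝒮.combo d := by
  simp only [combo, Finset.smul_sum, Pi.smul_apply, smul_eq_mul, mul_smul]

theorem majorized_zero {f ν : S → ℝ} {ρ : P → ℝ} (hν : ∀ i, 0 ≤ ν i) (hρ : ∀ p, 0 ≤ ρ p) :
    𝒮.Majorized f ν ρ 0 :=
  ⟨Empty, inferInstance, Empty.elim, by simp, by simpa using hν, by simpa using hρ,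
    by simpa using hρ⟩

theorem Majorized.mono {f ν ν' : S → ℝ} {ρ ρ' : P → ℝ} {A : 𝓗 →L[ℂ] 𝓗}
    (h : 𝒮.Majorized f ν ρ A) (hν : ∀ i, ν i ≤ ν' i) (hρ : ∀ p, ρ p ≤ ρ' p) :
    𝒮.Majorized f ν' ρ' A := by
  obtain ⟨ι, hι, a, hA, h1, h2, h3⟩ := h
  exact ⟨ι, hι, a, hA, fun i => (h1 i).trans (hν i), fun p => (h2 p).trans (hρ p),
    fun p => (h3 p).trans (hρ p)⟩

theorem Majorized.add {f ν ν' : S → ℝ} {ρ ρ' : P → ℝ} {A B : 𝓗 →L[ℂ] 𝓗}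
    (hA : 𝒮.Majorized f ν ρ A) (hB : 𝒮.Majorized f ν' ρ' B) :
    𝒮.Majorized f (ν + ν') (ρ + ρ') (A + B) := by
  obtain ⟨ι, hι, a, rfl, a1, a2, a3⟩ := hA
  obtain ⟨κ, hκ, b, rfl, b1, b2, b3⟩ := hB
  refine ⟨ι ⊕ κ, inferInstance, Sum.elim a b, ?_, fun i => ?_, fun p => ?_, fun p => ?_⟩ <;>
    rw [Fintype.sum_sum_type]
  · rfl
  · exact add_le_add (a1 i) (b1 i)
  · exact add_le_add (a2 p) (b2 p)
  · exact add_le_add (a3 p) (b3 p)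

theorem majorized_combo {f : S → ℝ} (h1 : ∀ i, 1 ≤ f i) (h3 : ∀ i, f i ≤ 3) (d : P → ℂ) :
    𝒮.Majorized f (fun i => 3 ^ k * 𝒮.strength d i) (fun p => 3 ^ k * ‖d p‖) (𝒮.combo d) := by
  have hW : ∀ p, ∏ l ∈ 𝒮.supp p, f l ≤ 3 ^ k := fun p => by
    simpa using prod_union_le h1 h3 (𝒮.card_supp_le p) ∅
  refine ⟨P, inferInstance, fun p => Atom.single (d p) p, ?_, fun i => ?_, fun q => ?_,
    fun q => ?_⟩
  · simp [combo, Atom.single_op]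
  · simp only [strength, Finset.mul_sum]
    refine Finset.sum_le_sum fun p _ => ?_
    change (if i ∈ 𝒮.supp p then _ else _) ≤ _
    split_ifs
    · rw [mul_comm]
      exact mul_le_mul_of_nonneg_right (hW p) (mul_nonneg (norm_nonneg _) (𝒮.wt_nonneg p))
    · simp
  all_goals
    change ∑ p, (if p = q then ‖d p‖ * ∏ l ∈ 𝒮.supp p, f l else 0) ≤ _
    rw [Finset.sum_ite_eq' Finset.univ q, if_pos (Finset.mem_univ q), mul_comm]
    exact mul_le_mul_of_nonneg_right (hW q) (norm_nonneg _)

/-- The coefficient of the commutator of `d_p h_p` with an atom on the sites `Z`; it is set to zero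
where the commutator vanishes because `p` acts on other sites. -/
noncomputable def hitCoeff (𝒮 : PieceSystem S P 𝓗 k) (d : P → ℂ) (Z : Finset S) (p : P) : ℂ :=
  if Disjoint Z (𝒮.supp p) then 0 else d p

theorem sum_hitCoeff_le (d : P → ℂ) (Z : Finset S) :
    ∑ p, ‖𝒮.hitCoeff d Z p‖ * 𝒮.wt p ≤ ∑ i ∈ Z, 𝒮.strength d i := by
  simp only [strength]
  rw [Finset.sum_comm]
  refine Finset.sum_le_sum fun p _ => ?_
  have h0 : ∀ i ∈ Z, 0 ≤ if i ∈ 𝒮.supp p then ‖d p‖ * 𝒮.wt p else 0 := fun i _ => by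
    split_ifs
    · exact mul_nonneg (norm_nonneg _) (𝒮.wt_nonneg p)
    · rfl
  by_cases hd : Disjoint Z (𝒮.supp p)
  · simpa [hitCoeff, hd] using Finset.sum_nonneg h0
  · obtain ⟨i, hi, hip⟩ := Finset.not_disjoint_iff.1 hd
    simpa [hitCoeff, hd, hip] using Finset.single_le_sum h0 hi

/-- Bookkeeping for one commutator: the weight of an atom on `Z` before the step pays for the
remaining atom and for all new atoms that arise when a piece hits `Z`, on the two sides. -/
theorem weight_step {f f' : S → ℝ} {d : P → ℂ} (hf' : ∀ i, 1 ≤ f' i) (hf3 : ∀ i, f i ≤ 3)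
    (hstep : ∀ i, f' i + 6 * 3 ^ k * 𝒮.strength d i ≤ f i) (Z : Finset S) :
    ∏ i ∈ Z, f' i + 2 * ∑ p, ‖𝒮.hitCoeff d Z p‖ * 𝒮.wt p * ∏ i ∈ Z ∪ 𝒮.supp p, f' i
      ≤ ∏ i ∈ Z, f i := by
  have hs := strength_nonneg (𝒮 := 𝒮) d
  have hf'3 : ∀ i, f' i ≤ 3 := fun i => by
    have := hstep i; have := hf3 i
    have := mul_nonneg (show (0 : ℝ) ≤ 6 * 3 ^ k by positivity) (hs i)
    linarith
  have hW : 0 ≤ ∏ i ∈ Z, f' i := Finset.prod_nonneg fun i _ => zero_le_one.trans (hf' i)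
  refine le_trans ?_ (prod_mul_one_add_sum_le (η := 2 * 3 ^ k) (by positivity) hs
    (fun i => zero_le_one.trans (hf' i)) hf3 (fun i => by have := hstep i; linarith) Z)
  have : ∑ p, ‖𝒮.hitCoeff d Z p‖ * 𝒮.wt p * ∏ i ∈ Z ∪ 𝒮.supp p, f' i
      ≤ (∑ i ∈ Z, 𝒮.strength d i) * (3 ^ k * ∏ i ∈ Z, f' i) := by
    refine le_trans ?_ (mul_le_mul_of_nonneg_right (sum_hitCoeff_le d Z) (by positivity))
    rw [Finset.sum_mul]
    refine Finset.sum_le_sum fun p _ => ?_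
    exact mul_le_mul_of_nonneg_left (prod_union_le hf' hf'3 (𝒮.card_supp_le p) Z)
      (mul_nonneg (norm_nonneg _) (𝒮.wt_nonneg p))
  linarith

/-- The atoms hit by a given piece `p` all contain one of its at most `k` sites. -/
theorem sum_hit_le {ι : Type} [Fintype ι] (a : ι → 𝒮.Atom) {f : S → ℝ} {M : ℝ}
    (h1 : ∀ i, 1 ≤ f i) (h3 : ∀ i, f i ≤ 3) (hM : 0 ≤ M)
    (hν : ∀ i, ∑ j, (if i ∈ (a j).sites then (a j).size * ∏ l ∈ (a j).sites, f l else 0) ≤ M)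
    (d : P → ℂ) (p : P) :
    ∑ j, ‖𝒮.hitCoeff d (a j).sites p‖ * ((a j).size * ∏ l ∈ (a j).sites ∪ 𝒮.supp p, f l)
      ≤ ‖d p‖ * (3 ^ k * (k * M)) := by
  have hW : ∀ Z : Finset S, 0 ≤ ∏ i ∈ Z, f i := fun Z =>
    Finset.prod_nonneg fun i _ => zero_le_one.trans (h1 i)
  calc _ ≤ ∑ j, ‖d p‖ * (3 ^ k * ∑ i ∈ 𝒮.supp p,
          if i ∈ (a j).sites then (a j).size * ∏ l ∈ (a j).sites, f l else 0) := by
        refine Finset.sum_le_sum fun j _ => ?_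
        have h0 : ∀ i ∈ 𝒮.supp p,
            0 ≤ if i ∈ (a j).sites then (a j).size * ∏ l ∈ (a j).sites, f l else 0 :=
          fun i _ => by
            split_ifs
            · exact mul_nonneg (a j).size_nonneg (hW _)
            · rfl
        by_cases hd : Disjoint (a j).sites (𝒮.supp p)
        · simpa [hitCoeff, hd] using mul_nonneg (norm_nonneg (d p))
            (mul_nonneg (by positivity) (Finset.sum_nonneg h0))
        · obtain ⟨i, hi, hip⟩ := Finset.not_disjoint_iff.1 hd
          simp only [hitCoeff, hd, if_false]
          refine mul_le_mul_of_nonneg_left ?_ (norm_nonneg _)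
          have h2 := Finset.single_le_sum h0 hip
          rw [if_pos hi] at h2
          calc _ ≤ (a j).size * (3 ^ k * ∏ l ∈ (a j).sites, f l) :=
                mul_le_mul_of_nonneg_left (prod_union_le h1 h3 (𝒮.card_supp_le p) _)
                  (a j).size_nonneg
            _ = 3 ^ k * ((a j).size * ∏ l ∈ (a j).sites, f l) := by ring
            _ ≤ _ := mul_le_mul_of_nonneg_left h2 (by positivity)
    _ = ‖d p‖ * (3 ^ k * ∑ i ∈ 𝒮.supp p, ∑ j,
          if i ∈ (a j).sites then (a j).size * ∏ l ∈ (a j).sites, f l else 0) := by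
        rw [← Finset.mul_sum, ← Finset.mul_sum, Finset.sum_comm]
    _ ≤ ‖d p‖ * (3 ^ k * (k * M)) := by
        gcongr
        calc _ ≤ ∑ _i ∈ 𝒮.supp p, M := Finset.sum_le_sum fun i _ => hν i
          _ = (𝒮.supp p).card * M := by simp
          _ ≤ k * M := by
            gcongr
            exact_mod_cast 𝒮.card_supp_le p

theorem commutator_combo_op (a : 𝒮.Atom) (d : P → ℂ) :
    𝒮.combo d * a.op - a.op * 𝒮.combo d =
      ∑ p, ((a.mulLeft (𝒮.hitCoeff d a.sites p) p).op +
        (a.mulRight (-𝒮.hitCoeff d a.sites p) p).op) := by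
  rw [combo, Finset.sum_mul, Finset.mul_sum, ← Finset.sum_sub_distrib]
  refine Finset.sum_congr rfl fun p _ => ?_
  rw [Atom.mulLeft_op, Atom.mulRight_op, smul_mul_assoc, mul_smul_comm, neg_smul, ← sub_eq_add_neg,
    ← smul_sub, ← smul_sub]
  by_cases hd : Disjoint a.sites (𝒮.supp p)
  · rw [(𝒮.commute_of_mem_localAlg hd a.op_mem (𝒮.piece_mem_localAlg p)).eq]
    simp
  · simp [hitCoeff, hd]

/-- Adding the commutator with `D = ∑ d_p h_p` costs a decrease of the site weights by a multiple of
the strength of `D`: the smaller weights pay for the new atoms containing a given site of the old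
one. -/
theorem Majorized.add_commutator {f f' ν : S → ℝ} {ρ : P → ℝ} {A : 𝓗 →L[ℂ] 𝓗} {d : P → ℂ}
    {M : ℝ} (hM : 0 ≤ M) (h : 𝒮.Majorized f ν ρ A) (hν : ∀ i, ν i ≤ M)
    (hf' : ∀ i, 1 ≤ f' i) (hf3 : ∀ i, f i ≤ 3)
    (hstep : ∀ i, f' i + 6 * 3 ^ k * 𝒮.strength d i ≤ f i) :
    𝒮.Majorized f' (fun i => ν i + 2 * (3 ^ k * (k * M)) * 𝒮.strength d i)
      (fun p => ρ p + 3 ^ k * (k * M) * ‖d p‖)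
      (A + (𝒮.combo d * A - A * 𝒮.combo d)) := by
  obtain ⟨ι, hι, a, rfl, a1, a2, a3⟩ := h
  have hs := strength_nonneg (𝒮 := 𝒮) d
  have hff : ∀ i, f' i ≤ f i := fun i => by
    have := hstep i
    have := mul_nonneg (show (0 : ℝ) ≤ 6 * 3 ^ k by positivity) (hs i)
    linarith
  have hf'3 : ∀ i, f' i ≤ 3 := fun i => (hff i).trans (hf3 i)
  have hW : ∀ Z : Finset S, 0 ≤ ∏ i ∈ Z, f' i := fun Z =>
    Finset.prod_nonneg fun i _ => zero_le_one.trans (hf' i)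
  have hWW : ∀ Z : Finset S, ∏ i ∈ Z, f' i ≤ ∏ i ∈ Z, f i := fun Z =>
    Finset.prod_le_prod (fun i _ => zero_le_one.trans (hf' i)) fun i _ => hff i
  have hhit := sum_hit_le a hf' hf'3 hM (fun i => le_trans (Finset.sum_le_sum fun j _ => by
    split_ifs
    · exact mul_le_mul_of_nonneg_left (hWW _) (a j).size_nonneg
    · rfl) ((a1 i).trans (hν i))) d
  have hstepW := fun j => weight_step hf' hf3 hstep (a j).sites
  have hnn : ∀ j p, 0 ≤ ‖𝒮.hitCoeff d (a j).sites p‖ * 𝒮.wt p *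
      ∏ i ∈ (a j).sites ∪ 𝒮.supp p, f' i := fun j p =>
    mul_nonneg (mul_nonneg (norm_nonneg _) (𝒮.wt_nonneg p)) (hW _)
  refine ⟨ι ⊕ (ι × P ⊕ ι × P), inferInstance,
    Sum.elim a (Sum.elim (fun q => (a q.1).mulLeft (𝒮.hitCoeff d (a q.1).sites q.2) q.2)
      (fun q => (a q.1).mulRight (-𝒮.hitCoeff d (a q.1).sites q.2) q.2)), ?_, fun i => ?_,
    fun q => ?_, fun q => ?_⟩ <;>
    rw [Fintype.sum_sum_type, Fintype.sum_sum_type, Fintype.sum_prod_type, Fintype.sum_prod_type]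
  · rw [Finset.mul_sum, Finset.sum_mul, ← Finset.sum_sub_distrib, ← Finset.sum_add_distrib]
    change _ = ∑ j, (a j).op +
      (∑ j, ∑ p, ((a j).mulLeft (𝒮.hitCoeff d (a j).sites p) p).op +
        ∑ j, ∑ p, ((a j).mulRight (-𝒮.hitCoeff d (a j).sites p) p).op)
    simp only [commutator_combo_op, Finset.sum_add_distrib]
  · change ∑ j, (if i ∈ (a j).sites then (a j).size * ∏ l ∈ (a j).sites, f' l else 0) +
        (∑ j, ∑ p, (if i ∈ (a j).sites ∪ 𝒮.supp p then
          ‖𝒮.hitCoeff d (a j).sites p‖ * 𝒮.wt p * (a j).size *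
            ∏ l ∈ (a j).sites ∪ 𝒮.supp p, f' l else 0) +
        ∑ j, ∑ p, (if i ∈ (a j).sites ∪ 𝒮.supp p then
          ‖-𝒮.hitCoeff d (a j).sites p‖ * 𝒮.wt p * (a j).size *
            ∏ l ∈ (a j).sites ∪ 𝒮.supp p, f' l else 0)) ≤ _
    simp only [norm_neg]
    rw [← two_mul]
    -- A new atom contains `i` because the old atom does, or because the hitting piece does.
    calc _ ≤ ∑ j, ((if i ∈ (a j).sites then (a j).size * ∏ l ∈ (a j).sites, f' l else 0) +
          2 * ∑ p, ((if i ∈ (a j).sites then ‖𝒮.hitCoeff d (a j).sites p‖ * 𝒮.wt p * (a j).size *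
              ∏ l ∈ (a j).sites ∪ 𝒮.supp p, f' l else 0) +
            (if i ∈ 𝒮.supp p then ‖𝒮.hitCoeff d (a j).sites p‖ * 𝒮.wt p * (a j).size *
              ∏ l ∈ (a j).sites ∪ 𝒮.supp p, f' l else 0))) := by
          rw [Finset.mul_sum, ← Finset.sum_add_distrib]
          refine Finset.sum_le_sum fun j _ => ?_
          gcongr with p
          have h0 := mul_nonneg (hnn j p) (a j).size_nonneg
          have h0' : 0 ≤ ‖𝒮.hitCoeff d (a j).sites p‖ * 𝒮.wt p * (a j).size *
              ∏ l ∈ (a j).sites ∪ 𝒮.supp p, f' l := by linarith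
          by_cases h1 : i ∈ (a j).sites <;> by_cases h2 : i ∈ 𝒮.supp p <;> simp [h1, h2]
          exact h0'
      _ = ∑ j, (if i ∈ (a j).sites then (a j).size * (∏ l ∈ (a j).sites, f' l +
            2 * ∑ p, ‖𝒮.hitCoeff d (a j).sites p‖ * 𝒮.wt p *
              ∏ l ∈ (a j).sites ∪ 𝒮.supp p, f' l) else 0) +
          2 * ∑ p, (if i ∈ 𝒮.supp p then 𝒮.wt p * ∑ j, ‖𝒮.hitCoeff d (a j).sites p‖ *
            ((a j).size * ∏ l ∈ (a j).sites ∪ 𝒮.supp p, f' l) else 0) := by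
          have : ∑ p, (if i ∈ 𝒮.supp p then 𝒮.wt p * ∑ j, ‖𝒮.hitCoeff d (a j).sites p‖ *
            ((a j).size * ∏ l ∈ (a j).sites ∪ 𝒮.supp p, f' l) else 0) =
            ∑ j, ∑ p, (if i ∈ 𝒮.supp p then ‖𝒮.hitCoeff d (a j).sites p‖ * 𝒮.wt p *
              (a j).size * ∏ l ∈ (a j).sites ∪ 𝒮.supp p, f' l else 0) := by
            rw [Finset.sum_comm]
            refine Finset.sum_congr rfl fun p _ => ?_
            split_ifs
            · rw [Finset.mul_sum]
              exact Finset.sum_congr rfl fun j _ => by ring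
            · simp
          rw [this, Finset.mul_sum, ← Finset.sum_add_distrib]
          refine Finset.sum_congr rfl fun j _ => ?_
          rw [Finset.sum_add_distrib, mul_add, ← add_assoc]
          congr 1
          split_ifs
          · rw [mul_add, mul_left_comm, Finset.mul_sum (a := (a j).size)]
            congr 2
            exact Finset.sum_congr rfl fun j _ => by ring
          · simp
      _ ≤ ν i + 2 * ∑ p, (if i ∈ 𝒮.supp p then 𝒮.wt p * (‖d p‖ * (3 ^ k * (k * M))) else 0) := by
          refine add_le_add (le_trans (Finset.sum_le_sum fun j _ => ?_) (a1 i)) ?_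
          · split_ifs
            · exact mul_le_mul_of_nonneg_left (hstepW j) (a j).size_nonneg
            · rfl
          · gcongr with p
            split_ifs
            · exact mul_le_mul_of_nonneg_left (hhit p) (𝒮.wt_nonneg p)
            · rfl
      _ = _ := by
          rw [strength, mul_assoc 2, Finset.mul_sum (a := 3 ^ k * (k * M))]
          congr 2
          refine Finset.sum_congr rfl fun p _ => ?_
          split_ifs
          · ring
          · simp
  · change ∑ j, (if (a j).left = q then (a j).lw * ∏ l ∈ (a j).sites, f' l else 0) +
        (∑ j, ∑ p, (if p = q then ‖𝒮.hitCoeff d (a j).sites p‖ * (a j).size *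
            ∏ l ∈ (a j).sites ∪ 𝒮.supp p, f' l else 0) +
        ∑ j, ∑ p, (if (a j).left = q then ‖-𝒮.hitCoeff d (a j).sites p‖ * 𝒮.wt p * (a j).lw *
            ∏ l ∈ (a j).sites ∪ 𝒮.supp p, f' l else 0)) ≤ _
    simp only [norm_neg]
    calc _ = ∑ j, (if (a j).left = q then (a j).lw * (∏ l ∈ (a j).sites, f' l +
            ∑ p, ‖𝒮.hitCoeff d (a j).sites p‖ * 𝒮.wt p *
              ∏ l ∈ (a j).sites ∪ 𝒮.supp p, f' l) else 0) +
          ∑ j, ‖𝒮.hitCoeff d (a j).sites q‖ *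
            ((a j).size * ∏ l ∈ (a j).sites ∪ 𝒮.supp q, f' l) := by
          rw [add_comm (∑ j, ∑ p, _), ← add_assoc, ← Finset.sum_add_distrib]
          congr 1
          · refine Finset.sum_congr rfl fun j _ => ?_
            split_ifs
            · rw [mul_add, Finset.mul_sum]
              congr 1
              exact Finset.sum_congr rfl fun j _ => by ring
            · simp
          · refine Finset.sum_congr rfl fun j _ => ?_
            rw [Finset.sum_ite_eq' Finset.univ q, if_pos (Finset.mem_univ q)]
            ring
      _ ≤ _ := by
          refine add_le_add (le_trans (Finset.sum_le_sum fun j _ => ?_) (a2 q))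
            ((hhit q).trans_eq (mul_comm _ _))
          split_ifs
          · refine mul_le_mul_of_nonneg_left (le_trans ?_ (hstepW j)) (a j).lw_nonneg
            have := Finset.sum_nonneg fun p (_ : p ∈ Finset.univ) => hnn j p
            linarith
          · rfl
  · change ∑ j, (if (a j).right = q then (a j).rw * ∏ l ∈ (a j).sites, f' l else 0) +
        (∑ j, ∑ p, (if (a j).right = q then ‖𝒮.hitCoeff d (a j).sites p‖ * 𝒮.wt p * (a j).rw *
            ∏ l ∈ (a j).sites ∪ 𝒮.supp p, f' l else 0) +
        ∑ j, ∑ p, (if p = q then ‖-𝒮.hitCoeff d (a j).sites p‖ * (a j).size *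
            ∏ l ∈ (a j).sites ∪ 𝒮.supp p, f' l else 0)) ≤ _
    simp only [norm_neg]
    calc _ = ∑ j, (if (a j).right = q then (a j).rw * (∏ l ∈ (a j).sites, f' l +
            ∑ p, ‖𝒮.hitCoeff d (a j).sites p‖ * 𝒮.wt p *
              ∏ l ∈ (a j).sites ∪ 𝒮.supp p, f' l) else 0) +
          ∑ j, ‖𝒮.hitCoeff d (a j).sites q‖ *
            ((a j).size * ∏ l ∈ (a j).sites ∪ 𝒮.supp q, f' l) := by
          rw [← add_assoc, ← Finset.sum_add_distrib]
          congr 1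
          · refine Finset.sum_congr rfl fun j _ => ?_
            split_ifs
            · rw [mul_add, Finset.mul_sum]
              congr 1
              exact Finset.sum_congr rfl fun j _ => by ring
            · simp
          · refine Finset.sum_congr rfl fun j _ => ?_
            rw [Finset.sum_ite_eq' Finset.univ q, if_pos (Finset.mem_univ q)]
            ring
      _ ≤ _ := by
          refine add_le_add (le_trans (Finset.sum_le_sum fun j _ => ?_) (a3 q))
            ((hhit q).trans_eq (mul_comm _ _))
          split_ifs
          · refine mul_le_mul_of_nonneg_left (le_trans ?_ (hstepW j)) (a j).rw_nonneg
            have := Finset.sum_nonneg fun p (_ : p ∈ Finset.univ) => hnn j p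
            linarith
          · rfl

end PieceSystem

/-! ### Majorized operators on low-energy vectors -/

theorem sum_not_disjoint_le {ι S : Type} [Fintype ι] [DecidableEq S] (Z : ι → Finset S)
    {n : ι → ℝ} (hn : ∀ j, 0 ≤ n j) {M : ℝ} (hM : ∀ i, ∑ j, (if i ∈ Z j then n j else 0) ≤ M)
    (Y : Finset S) : ∑ j, (if Disjoint (Z j) Y then 0 else n j) ≤ Y.card * M := by
  calc _ ≤ ∑ j, ∑ i ∈ Y, (if i ∈ Z j then n j else 0) := by
        refine Finset.sum_le_sum fun j _ => ?_
        have h0 : ∀ i ∈ Y, 0 ≤ if i ∈ Z j then n j else 0 := fun i _ => by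
          split_ifs
          · exact hn j
          · rfl
        by_cases hd : Disjoint (Z j) Y
        · simpa [hd] using Finset.sum_nonneg h0
        · obtain ⟨i, hi, hiY⟩ := Finset.not_disjoint_iff.1 hd
          simpa [hd, hi] using Finset.single_le_sum h0 hiY
    _ = ∑ i ∈ Y, ∑ j, (if i ∈ Z j then n j else 0) := Finset.sum_comm
    _ ≤ ∑ _i ∈ Y, M := Finset.sum_le_sum fun i _ => hM i
    _ = Y.card * M := by simp

theorem le_half_add_of_sq_le_mul {x a b : ℝ} (ha : 0 ≤ a) (hb : 0 ≤ b) (h : x ^ 2 ≤ a * b) :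
    x ≤ (a + b) / 2 := by
  refine le_of_sq_le_sq ?_ (by positivity)
  nlinarith [sq_nonneg (a - b)]

namespace PieceSystem

set_option linter.unusedSectionVars false

variable {S P : Type} [DecidableEq S] [Fintype P] [DecidableEq P]
  {𝓗 : Type} [NormedAddCommGroup 𝓗] [InnerProductSpace ℂ 𝓗] [CompleteSpace 𝓗] {k : ℕ}
  {𝒮 : PieceSystem S P 𝓗 k}

theorem norm_piece_apply_sq_le (p : P) (ψ : 𝓗) :
    ‖𝒮.piece p ψ‖ ^ 2 ≤ 𝒮.wt p * ‖𝒮.root p ψ‖ ^ 2 := by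
  have h : ‖𝒮.piece p ψ‖ ≤ ‖𝒮.root p‖ * ‖𝒮.root p ψ‖ := by
    rw [← norm_star (𝒮.root p)]
    exact ContinuousLinearMap.le_opNorm (star (𝒮.root p)) (𝒮.root p ψ)
  calc _ ≤ (‖𝒮.root p‖ * ‖𝒮.root p ψ‖) ^ 2 := by gcongr
    _ = ‖𝒮.root p‖ ^ 2 * ‖𝒮.root p ψ‖ ^ 2 := by ring
    _ ≤ _ := by gcongr; exact 𝒮.norm_root_sq_le p

theorem Atom.norm_op_apply_sq_le (a : 𝒮.Atom) (ψ : 𝓗) :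
    ‖a.op ψ‖ ^ 2 ≤ a.size * (a.rw * ‖𝒮.root a.right ψ‖ ^ 2) := by
  have h : ‖a.op ψ‖ ≤ ‖𝒮.root a.left‖ * (‖a.core‖ * ‖𝒮.root a.right ψ‖) := by
    rw [← norm_star (𝒮.root a.left)]
    refine (ContinuousLinearMap.le_opNorm (star (𝒮.root a.left)) _).trans ?_
    gcongr
    exact ContinuousLinearMap.le_opNorm _ _
  calc _ ≤ (‖𝒮.root a.left‖ * (‖a.core‖ * ‖𝒮.root a.right ψ‖)) ^ 2 := by gcongr
    _ = ‖𝒮.root a.left‖ ^ 2 * ‖a.core‖ ^ 2 * ‖𝒮.root a.right ψ‖ ^ 2 := by ring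
    _ ≤ 𝒮.wt a.left * (a.lw * a.rw) * ‖𝒮.root a.right ψ‖ ^ 2 := by
      have := 𝒮.wt_nonneg a.left
      gcongr
      · exact 𝒮.norm_root_sq_le _
      · exact a.norm_core_sq_le
    _ = 𝒮.wt a.left * a.lw * (a.rw * ‖𝒮.root a.right ψ‖ ^ 2) := by ring
    _ ≤ _ := by
      have := a.rw_nonneg
      gcongr
      exact a.wt_mul_lw_le

/-- For two atoms on disjoint sets of sites the commuting roots can be moved to the outside, which
bounds the matrix element by products of pieces, without any loss from operator norms of the
roots. -/
theorem Atom.norm_inner_le_of_disjoint (a b : 𝒮.Atom) (h : Disjoint a.sites b.sites) (ψ : 𝓗) :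
    ‖inner ℂ (a.op ψ) (b.op ψ)‖ ≤
      (a.rw * b.lw * ‖𝒮.root b.left (𝒮.root a.right ψ)‖ ^ 2 +
        b.rw * a.lw * ‖𝒮.root a.left (𝒮.root b.right ψ)‖ ^ 2) / 2 := by
  have hx' : star (𝒮.root b.left) ∈ 𝒮.localAlg b.sites :=
    star_mem (𝒮.root_mem_localAlg b.left_subset)
  have hx : 𝒮.root a.left ∈ 𝒮.localAlg a.sites := 𝒮.root_mem_localAlg a.left_subset
  have c1 := (𝒮.commute_of_mem_localAlg h hx hx').eq
  have c2 := (𝒮.commute_of_mem_localAlg h (star_mem a.core_mem) hx').eq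
  have c3 := (𝒮.commute_of_mem_localAlg h hx b.core_mem).eq
  have hop : star a.op * b.op = star (𝒮.root b.left * 𝒮.root a.right) *
      (star a.core * b.core * (𝒮.root a.left * 𝒮.root b.right)) := by
    simp only [op, star_mul, star_star]
    calc _ = star (𝒮.root a.right) * (star a.core * (𝒮.root a.left * star (𝒮.root b.left))) *
          b.core * 𝒮.root b.right := by simp only [mul_assoc]
      _ = star (𝒮.root a.right) * ((star a.core * star (𝒮.root b.left)) *
          (𝒮.root a.left * b.core) * 𝒮.root b.right) := by rw [c1]; simp only [mul_assoc]
      _ = _ := by rw [c2, c3]; simp only [mul_assoc]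
  have hin : inner ℂ (a.op ψ) (b.op ψ) = inner ℂ ((𝒮.root b.left * 𝒮.root a.right) ψ)
      ((star a.core * b.core * (𝒮.root a.left * 𝒮.root b.right)) ψ) := by
    have e1 := ContinuousLinearMap.adjoint_inner_right a.op ψ (b.op ψ)
    have e2 := ContinuousLinearMap.adjoint_inner_right (𝒮.root b.left * 𝒮.root a.right) ψ
      ((star a.core * b.core * (𝒮.root a.left * 𝒮.root b.right)) ψ)
    rw [← e1, ← e2]
    exact congrArg (inner ℂ ψ) (DFunLike.congr_fun hop ψ)
  rw [hin]
  refine le_half_add_of_sq_le_mul (mul_nonneg (mul_nonneg a.rw_nonneg b.lw_nonneg) (sq_nonneg _))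
    (mul_nonneg (mul_nonneg b.rw_nonneg a.lw_nonneg) (sq_nonneg _)) ?_
  have h1 : ‖(star a.core * b.core * (𝒮.root a.left * 𝒮.root b.right)) ψ‖ ≤
      ‖a.core‖ * ‖b.core‖ * ‖𝒮.root a.left (𝒮.root b.right ψ)‖ := by
    refine (ContinuousLinearMap.le_opNorm (star a.core * b.core) _).trans ?_
    rw [← norm_star a.core]
    exact mul_le_mul_of_nonneg_right (norm_mul_le _ _) (norm_nonneg _)
  have h2 := (norm_inner_le_norm (𝕜 := ℂ) ((𝒮.root b.left * 𝒮.root a.right) ψ)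
    ((star a.core * b.core * (𝒮.root a.left * 𝒮.root b.right)) ψ)).trans
    (mul_le_mul_of_nonneg_left h1 (norm_nonneg _))
  calc _ ≤ (‖𝒮.root b.left (𝒮.root a.right ψ)‖ *
        (‖a.core‖ * ‖b.core‖ * ‖𝒮.root a.left (𝒮.root b.right ψ)‖)) ^ 2 := by
        gcongr
        exact h2
    _ = (‖a.core‖ ^ 2 * ‖b.core‖ ^ 2) * (‖𝒮.root b.left (𝒮.root a.right ψ)‖ ^ 2 *
        ‖𝒮.root a.left (𝒮.root b.right ψ)‖ ^ 2) := by ring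
    _ ≤ ((a.lw * a.rw) * (b.lw * b.rw)) * (‖𝒮.root b.left (𝒮.root a.right ψ)‖ ^ 2 *
        ‖𝒮.root a.left (𝒮.root b.right ψ)‖ ^ 2) := by
        have := a.norm_core_sq_le
        gcongr
        · exact (sq_nonneg _).trans this
        · exact b.norm_core_sq_le
    _ = _ := by ring

theorem norm_sum_sq_le {ι : Type} [Fintype ι] (v : ι → 𝓗) {B : ι → ι → ℝ}
    (h : ∀ i j, RCLike.re (inner ℂ (v i) (v j)) ≤ B i j) : ‖∑ i, v i‖ ^ 2 ≤ ∑ i, ∑ j, B i j := by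
  rw [← inner_self_eq_norm_sq (𝕜 := ℂ), sum_inner, map_sum]
  refine Finset.sum_le_sum fun i _ => ?_
  rw [inner_sum, map_sum]
  exact Finset.sum_le_sum fun j _ => h i j

/-- Products of pieces on disjoint sets are positive and are part of `H²`; the remaining terms
of `H²` are bounded by the energy. -/
theorem sum_disjoint_le {G : ℝ} (hG0 : 0 ≤ G)
    (hG : ∀ i, ∑ p, (if i ∈ 𝒮.supp p then 𝒮.wt p else 0) ≤ G) (ψ : 𝓗) :
    ∑ p, ∑ q, (if Disjoint (𝒮.supp p) (𝒮.supp q) then ‖𝒮.root q (𝒮.root p ψ)‖ ^ 2 else 0) ≤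
      ‖∑ p, 𝒮.piece p ψ‖ ^ 2 + k * G * ∑ p, ‖𝒮.root p ψ‖ ^ 2 := by
  have hpair : ∀ p q, (if Disjoint (𝒮.supp p) (𝒮.supp q) then ‖𝒮.root q (𝒮.root p ψ)‖ ^ 2 else 0) ≤
      RCLike.re (inner ℂ (𝒮.piece p ψ) (𝒮.piece q ψ)) +
      ((if Disjoint (𝒮.supp p) (𝒮.supp q) then 0 else 𝒮.wt p) * ‖𝒮.root q ψ‖ ^ 2 +
        (if Disjoint (𝒮.supp q) (𝒮.supp p) then 0 else 𝒮.wt q) * ‖𝒮.root p ψ‖ ^ 2) / 2 := by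
    intro p q
    by_cases hd : Disjoint (𝒮.supp p) (𝒮.supp q)
    · simp only [hd, hd.symm, if_true, zero_mul, add_zero, zero_div]
      refine le_of_eq ?_
      have c1 := (𝒮.commute_of_mem_localAlg hd (𝒮.root_mem_localAlg subset_rfl)
        (𝒮.piece_mem_localAlg q)).eq
      have hop : star (𝒮.root q * 𝒮.root p) * (𝒮.root q * 𝒮.root p) =
          star (𝒮.piece p) * 𝒮.piece q := by
        calc _ = star (𝒮.root p) * (𝒮.piece q * 𝒮.root p) := by
              simp only [piece, star_mul, mul_assoc]
          _ = _ := by rw [← c1]; simp only [piece, star_mul, star_star, mul_assoc]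
      have e1 := ContinuousLinearMap.adjoint_inner_right (𝒮.root q * 𝒮.root p) ψ
        ((𝒮.root q * 𝒮.root p) ψ)
      have e2 := ContinuousLinearMap.adjoint_inner_right (𝒮.piece p) ψ (𝒮.piece q ψ)
      have e3 : inner ℂ ((𝒮.root q * 𝒮.root p) ψ) ((𝒮.root q * 𝒮.root p) ψ) =
          inner ℂ (𝒮.piece p ψ) (𝒮.piece q ψ) := by
        rw [← e1, ← e2]
        exact congrArg (inner ℂ ψ) (DFunLike.congr_fun hop ψ)
      rw [← e3, inner_self_eq_norm_sq]
      rfl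
    · simp only [hd, if_false, mt (fun h => Disjoint.symm h) hd]
      have h1 := neg_le_of_abs_le ((RCLike.abs_re_le_norm _).trans
        (norm_inner_le_norm (𝕜 := ℂ) (𝒮.piece p ψ) (𝒮.piece q ψ)))
      have h2 : ‖𝒮.piece p ψ‖ * ‖𝒮.piece q ψ‖ ≤
          (𝒮.wt p * ‖𝒮.root q ψ‖ ^ 2 + 𝒮.wt q * ‖𝒮.root p ψ‖ ^ 2) / 2 := by
        have hp := 𝒮.wt_nonneg p
        have hq := 𝒮.wt_nonneg q
        refine le_half_add_of_sq_le_mul (by positivity) (by positivity) ?_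
        calc _ = ‖𝒮.piece p ψ‖ ^ 2 * ‖𝒮.piece q ψ‖ ^ 2 := by ring
          _ ≤ (𝒮.wt p * ‖𝒮.root p ψ‖ ^ 2) * (𝒮.wt q * ‖𝒮.root q ψ‖ ^ 2) := by
            gcongr
            · exact norm_piece_apply_sq_le p ψ
            · exact norm_piece_apply_sq_le q ψ
          _ = _ := by ring
      linarith
  have hover : ∑ p, ∑ q, (if Disjoint (𝒮.supp p) (𝒮.supp q) then 0 else 𝒮.wt p) *
      ‖𝒮.root q ψ‖ ^ 2 ≤ k * G * ∑ p, ‖𝒮.root p ψ‖ ^ 2 := by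
    rw [Finset.sum_comm, Finset.mul_sum]
    refine Finset.sum_le_sum fun q _ => ?_
    rw [← Finset.sum_mul]
    refine mul_le_mul_of_nonneg_right ?_ (sq_nonneg _)
    refine (sum_not_disjoint_le 𝒮.supp 𝒮.wt_nonneg hG (𝒮.supp q)).trans ?_
    gcongr
    exact_mod_cast 𝒮.card_supp_le q
  have hover' : ∑ p, ∑ q, (if Disjoint (𝒮.supp q) (𝒮.supp p) then 0 else 𝒮.wt q) *
      ‖𝒮.root p ψ‖ ^ 2 ≤ k * G * ∑ p, ‖𝒮.root p ψ‖ ^ 2 := Finset.sum_comm.trans_le hover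
  have hsq : ‖∑ p, 𝒮.piece p ψ‖ ^ 2 =
      ∑ p, ∑ q, RCLike.re (inner ℂ (𝒮.piece p ψ) (𝒮.piece q ψ)) := by
    rw [← inner_self_eq_norm_sq (𝕜 := ℂ), sum_inner, map_sum]
    refine Finset.sum_congr rfl fun i _ => ?_
    rw [inner_sum, map_sum]
  refine (Finset.sum_le_sum fun p _ => Finset.sum_le_sum fun q _ => hpair p q).trans ?_
  simp only [Finset.sum_add_distrib, ← Finset.sum_div, ← hsq]
  linarith

/-- A majorized operator is bounded on vectors by the Hamiltonian `H = ∑ h_p`, up to corrections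
of lower order in the energy: atoms on disjoint sets contribute at most `β² H²`, and those
that overlap contribute at most `M β H`. -/
theorem Majorized.norm_apply_sq_le {f ν : S → ℝ} {ρ : P → ℝ} {A : 𝓗 →L[ℂ] 𝓗}
    (h : 𝒮.Majorized f ν ρ A) (hf : ∀ i, 2 ≤ f i) {M β G : ℝ} (hM : 0 ≤ M) (hβ : 0 ≤ β)
    (hG0 : 0 ≤ G) (hν : ∀ i, ν i ≤ M) (hρ : ∀ p, ρ p ≤ β)
    (hG : ∀ i, ∑ p, (if i ∈ 𝒮.supp p then 𝒮.wt p else 0) ≤ G) (ψ : 𝓗) :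
    ‖A ψ‖ ^ 2 ≤ β ^ 2 * ‖∑ p, 𝒮.piece p ψ‖ ^ 2 +
      (β ^ 2 * (k * G) + M * β) * ∑ p, ‖𝒮.root p ψ‖ ^ 2 := by
  obtain ⟨ι, hι, a, rfl, a1, a2, a3⟩ := h
  have hWcard : ∀ Z : Finset S, (Z.card : ℝ) ≤ ∏ i ∈ Z, f i := fun Z => by
    calc (Z.card : ℝ) ≤ 2 ^ Z.card := by exact_mod_cast Nat.lt_two_pow_self.le
      _ = ∏ _i ∈ Z, (2 : ℝ) := by simp
      _ ≤ _ := Finset.prod_le_prod (fun _ _ => zero_le_two) fun i _ => hf i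
  have hW1 : ∀ Z : Finset S, (1 : ℝ) ≤ ∏ i ∈ Z, f i := fun Z => by
    calc (1 : ℝ) = ∏ _i ∈ Z, (1 : ℝ) := by simp
      _ ≤ _ := Finset.prod_le_prod (fun _ _ => zero_le_one) fun i _ => one_le_two.trans (hf i)
  have hN : ∀ i, ∑ j, (if i ∈ (a j).sites then (a j).size else 0) ≤ M := fun i => by
    refine le_trans (Finset.sum_le_sum fun j _ => ?_) ((a1 i).trans (hν i))
    split_ifs
    · exact le_mul_of_one_le_right (a j).size_nonneg (hW1 _)
    · rfl
  have hL : ∀ p, ∑ j, (if (a j).left = p then (a j).lw else 0) ≤ β := fun p => by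
    refine le_trans (Finset.sum_le_sum fun j _ => ?_) ((a2 p).trans (hρ p))
    split_ifs
    · exact le_mul_of_one_le_right (a j).lw_nonneg (hW1 _)
    · rfl
  have hR : ∀ p, ∑ j, (if (a j).right = p then (a j).rw else 0) ≤ β := fun p => by
    refine le_trans (Finset.sum_le_sum fun j _ => ?_) ((a3 p).trans (hρ p))
    split_ifs
    · exact le_mul_of_one_le_right (a j).rw_nonneg (hW1 _)
    · rfl
  have hpair : ∀ i j, RCLike.re (inner ℂ ((a i).op ψ) ((a j).op ψ)) ≤
      ((if Disjoint (a i).sites (a j).sites then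
          (a i).rw * (a j).lw * ‖𝒮.root (a j).left (𝒮.root (a i).right ψ)‖ ^ 2 else 0) +
        (if Disjoint (a j).sites (a i).sites then
          (a j).rw * (a i).lw * ‖𝒮.root (a i).left (𝒮.root (a j).right ψ)‖ ^ 2 else 0)) / 2 +
      ((if Disjoint (a i).sites (a j).sites then 0 else (a i).size) *
          ((a j).rw * ‖𝒮.root (a j).right ψ‖ ^ 2) +
        (if Disjoint (a j).sites (a i).sites then 0 else (a j).size) *
          ((a i).rw * ‖𝒮.root (a i).right ψ‖ ^ 2)) / 2 := by
    intro i j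
    refine (RCLike.re_le_norm _).trans ?_
    by_cases hd : Disjoint (a i).sites (a j).sites
    · simp only [hd, hd.symm, if_true, zero_mul, add_zero, zero_div]
      exact (a i).norm_inner_le_of_disjoint (a j) hd ψ
    · simp only [hd, mt (fun h => Disjoint.symm h) hd, if_false, add_zero, zero_div, zero_add]
      have hi := mul_nonneg (a i).rw_nonneg (sq_nonneg ‖𝒮.root (a i).right ψ‖)
      have hj := mul_nonneg (a j).rw_nonneg (sq_nonneg ‖𝒮.root (a j).right ψ‖)
      have hi' := (a i).size_nonneg
      have hj' := (a j).size_nonneg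
      refine (norm_inner_le_norm _ _).trans
        (le_half_add_of_sq_le_mul (mul_nonneg hi' hj) (mul_nonneg hj' hi) ?_)
      calc _ = ‖(a i).op ψ‖ ^ 2 * ‖(a j).op ψ‖ ^ 2 := by ring
        _ ≤ ((a i).size * ((a i).rw * ‖𝒮.root (a i).right ψ‖ ^ 2)) *
            ((a j).size * ((a j).rw * ‖𝒮.root (a j).right ψ‖ ^ 2)) := by
          gcongr
          · exact (a i).norm_op_apply_sq_le ψ
          · exact (a j).norm_op_apply_sq_le ψ
        _ = _ := by ring
  have hover : ∑ i, ∑ j, (if Disjoint (a i).sites (a j).sites then 0 else (a i).size) *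
      ((a j).rw * ‖𝒮.root (a j).right ψ‖ ^ 2) ≤ M * β * ∑ p, ‖𝒮.root p ψ‖ ^ 2 := by
    rw [Finset.sum_comm]
    calc _ ≤ ∑ j, M * ∑ p, (if (a j).right = p then
          (a j).rw * ∏ l ∈ (a j).sites, f l else 0) * ‖𝒮.root p ψ‖ ^ 2 := by
          refine Finset.sum_le_sum fun j _ => ?_
          have hj := mul_nonneg (a j).rw_nonneg (sq_nonneg ‖𝒮.root (a j).right ψ‖)
          have e : ∑ p, (if (a j).right = p then (a j).rw * ∏ l ∈ (a j).sites, f l else 0) *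
              ‖𝒮.root p ψ‖ ^ 2 =
              (a j).rw * (∏ l ∈ (a j).sites, f l) * ‖𝒮.root (a j).right ψ‖ ^ 2 := by simp
          rw [e, ← Finset.sum_mul]
          calc _ ≤ ((a j).sites.card * M) * ((a j).rw * ‖𝒮.root (a j).right ψ‖ ^ 2) :=
                mul_le_mul_of_nonneg_right (sum_not_disjoint_le (fun i => (a i).sites)
                  (fun i => (a i).size_nonneg) hN (a j).sites) hj
            _ ≤ ((∏ l ∈ (a j).sites, f l) * M) * ((a j).rw * ‖𝒮.root (a j).right ψ‖ ^ 2) := by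
                gcongr
                exact hWcard _
            _ = _ := by ring
      _ = M * ∑ p, (∑ j, (if (a j).right = p then
          (a j).rw * ∏ l ∈ (a j).sites, f l else 0)) * ‖𝒮.root p ψ‖ ^ 2 := by
          rw [← Finset.mul_sum, Finset.sum_comm]
          simp only [Finset.sum_mul]
      _ ≤ M * ∑ p, β * ‖𝒮.root p ψ‖ ^ 2 := by
          gcongr with p
          exact (a3 p).trans (hρ p)
      _ = _ := by rw [← Finset.mul_sum]; ring
  have hover' : ∑ i, ∑ j, (if Disjoint (a j).sites (a i).sites then 0 else (a j).size) *
      ((a i).rw * ‖𝒮.root (a i).right ψ‖ ^ 2) ≤ M * β * ∑ p, ‖𝒮.root p ψ‖ ^ 2 :=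
    Finset.sum_comm.trans_le hover
  have hdisj : ∑ i, ∑ j, (if Disjoint (a i).sites (a j).sites then
      (a i).rw * (a j).lw * ‖𝒮.root (a j).left (𝒮.root (a i).right ψ)‖ ^ 2 else 0) ≤
      β ^ 2 * (‖∑ p, 𝒮.piece p ψ‖ ^ 2 + k * G * ∑ p, ‖𝒮.root p ψ‖ ^ 2) := by
    set D : P → P → ℝ := fun p q =>
      if Disjoint (𝒮.supp p) (𝒮.supp q) then ‖𝒮.root q (𝒮.root p ψ)‖ ^ 2 else 0 with hD
    have hD0 : ∀ p q, 0 ≤ D p q := fun p q => by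
      simp only [hD]
      split_ifs
      · positivity
      · rfl
    calc _ ≤ ∑ i, ∑ j, (a i).rw * (a j).lw * D (a i).right (a j).left := by
          refine Finset.sum_le_sum fun i _ => Finset.sum_le_sum fun j _ => ?_
          split_ifs with hd
          · rw [hD]
            simp only [hd.mono (a i).right_subset (a j).left_subset, if_true]
            rfl
          · exact mul_nonneg (mul_nonneg (a i).rw_nonneg (a j).lw_nonneg) (hD0 _ _)
      _ = ∑ i, ∑ j, ∑ p, ∑ q, (if (a i).right = p then (a i).rw else 0) *
            (if (a j).left = q then (a j).lw else 0) * D p q := by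
          refine Finset.sum_congr rfl fun i _ => Finset.sum_congr rfl fun j _ => ?_
          simp [ite_mul, mul_ite]
      _ = ∑ p, ∑ q, (∑ i, if (a i).right = p then (a i).rw else 0) *
            (∑ j, if (a j).left = q then (a j).lw else 0) * D p q := by
          rw [Finset.sum_congr rfl fun i _ => Finset.sum_comm, Finset.sum_comm]
          refine Finset.sum_congr rfl fun p _ => ?_
          rw [Finset.sum_congr rfl fun i _ => Finset.sum_comm, Finset.sum_comm]
          refine Finset.sum_congr rfl fun q _ => ?_
          rw [Finset.sum_mul_sum]
          simp only [Finset.sum_mul]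
      _ ≤ ∑ p, ∑ q, β * β * D p q := by
          refine Finset.sum_le_sum fun p _ => Finset.sum_le_sum fun q _ => ?_
          refine mul_le_mul_of_nonneg_right ?_ (hD0 p q)
          refine mul_le_mul (hR p) (hL q) (Finset.sum_nonneg fun j _ => ?_) hβ
          split_ifs
          · exact (a j).lw_nonneg
          · rfl
      _ = β ^ 2 * ∑ p, ∑ q, D p q := by
          rw [Finset.mul_sum, sq]
          simp only [Finset.mul_sum]
      _ ≤ _ := mul_le_mul_of_nonneg_left (sum_disjoint_le hG0 hG ψ) (sq_nonneg β)
  have hdisj' : ∑ i, ∑ j, (if Disjoint (a j).sites (a i).sites then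
      (a j).rw * (a i).lw * ‖𝒮.root (a i).left (𝒮.root (a j).right ψ)‖ ^ 2 else 0) ≤
      β ^ 2 * (‖∑ p, 𝒮.piece p ψ‖ ^ 2 + k * G * ∑ p, ‖𝒮.root p ψ‖ ^ 2) :=
    Finset.sum_comm.trans_le hdisj
  rw [sum_apply]
  refine (norm_sum_sq_le _ hpair).trans ?_
  simp only [Finset.sum_add_distrib, ← Finset.sum_div]
  linarith

end PieceSystem

/-! ### Conjugation by exponentials -/

section Conjugation

set_option linter.unusedSectionVars false

variable {𝒜 : Type*} [NormedRing 𝒜] [NormedAlgebra ℂ 𝒜] [CompleteSpace 𝒜]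

theorem norm_pow_sub_pow_le_mul {E : Type*} [NormedRing E] (h1 : ‖(1 : E)‖ ≤ 1) {a b : E} {m : ℝ}
    (ha : ‖a‖ ≤ m) (hb : ‖b‖ ≤ m) (hm : 1 ≤ m) (n : ℕ) :
    ‖a ^ n - b ^ n‖ ≤ n * ‖a - b‖ * m ^ n := by
  have hpow : ∀ j : ℕ, ‖a ^ j‖ ≤ m ^ j := fun j => by
    rcases Nat.eq_zero_or_pos j with rfl | hj
    · simpa using h1
    · exact (norm_pow_le' a hj).trans (pow_le_pow_left₀ (norm_nonneg _) ha j)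
  induction n with
  | zero => simp
  | succ n ih =>
    have e : a ^ (n + 1) - b ^ (n + 1) = a ^ n * (a - b) + (a ^ n - b ^ n) * b := by
      rw [pow_succ, pow_succ]; noncomm_ring
    have hm0 : 0 ≤ m ^ n := by positivity
    calc _ ≤ ‖a ^ n‖ * ‖a - b‖ + ‖a ^ n - b ^ n‖ * ‖b‖ := by
          rw [e]
          exact (norm_add_le _ _).trans (add_le_add (norm_mul_le _ _) (norm_mul_le _ _))
      _ ≤ m ^ n * ‖a - b‖ + (n * ‖a - b‖ * m ^ n) * m := by
          gcongr
          exact hpow n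
      _ ≤ m ^ n * m * ‖a - b‖ + (n * ‖a - b‖ * m ^ n) * m := by
          gcongr
          exact le_mul_of_one_le_right hm0 hm
      _ = _ := by push_cast; ring

/-- If `c n = 1 + X / (n + 1) + o(1 / n)`, then `c n ^ (n + 1)` and `(1 + X / (n + 1)) ^ (n + 1)`
have the same limit. -/
theorem tendsto_pow_sub_pow {E : Type*} [NormedRing E] [NormedAlgebra ℂ E] (h1 : ‖(1 : E)‖ ≤ 1)
    {X : E} {c : ℕ → E} (hc : Tendsto (fun n : ℕ => ((n : ℂ) + 1) • (c n - 1)) atTop (𝓝 X)) :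
    Tendsto (fun n : ℕ => (1 + ((n : ℂ) + 1)⁻¹ • X) ^ (n + 1) - c n ^ (n + 1)) atTop (𝓝 0) := by
  have hd : Tendsto (fun n : ℕ => ‖X - ((n : ℂ) + 1) • (c n - 1)‖) atTop (𝓝 0) := by
    simpa using (tendsto_const_nhds (x := X).sub hc).norm
  have hb := hc.norm.eventually_le_const (lt_add_one ‖X‖)
  refine squeeze_zero_norm' ?_ (by simpa using hd.mul_const (Real.exp (‖X‖ + 1)))
  filter_upwards [hb] with n hn
  have hpos : (0 : ℝ) < n + 1 := by positivity
  have hnorm : ‖((n : ℂ) + 1)‖ = (n : ℝ) + 1 := by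
    have := Complex.norm_natCast (n + 1)
    push_cast at this
    exact this
  have hne : ((n : ℂ) + 1) ≠ 0 := by
    rw [← norm_ne_zero_iff, hnorm]; exact hpos.ne'
  have hcn : c n = 1 + ((n : ℂ) + 1)⁻¹ • (((n : ℂ) + 1) • (c n - 1)) := by
    rw [smul_smul, inv_mul_cancel₀ hne, one_smul]; abel
  have hm : ∀ Y : E, ‖Y‖ ≤ ‖X‖ + 1 →
      ‖1 + ((n : ℂ) + 1)⁻¹ • Y‖ ≤ 1 + (‖X‖ + 1) / (n + 1) := fun Y hY => by
    refine (norm_add_le _ _).trans (add_le_add h1 ?_)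
    rw [norm_smul, norm_inv, hnorm, div_eq_inv_mul]
    gcongr
  have hcn' : ‖c n‖ ≤ 1 + (‖X‖ + 1) / (n + 1) := by
    rw [hcn]
    exact hm _ hn
  have key := norm_pow_sub_pow_le_mul h1 (hm X (by linarith)) hcn'
    (by have : 0 ≤ (‖X‖ + 1) / (n + 1) := by positivity
        linarith) (n + 1)
  refine key.trans ?_
  have e : ((n : ℝ) + 1) * ‖1 + ((n : ℂ) + 1)⁻¹ • X - c n‖ = ‖X - ((n : ℂ) + 1) • (c n - 1)‖ := by
    rw [← hnorm, ← norm_smul]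
    congr 1
    rw [smul_sub, smul_add, smul_smul, mul_inv_cancel₀ hne, one_smul, smul_sub]
    abel
  push_cast
  rw [e]
  gcongr
  calc (1 + (‖X‖ + 1) / ((n : ℝ) + 1)) ^ (n + 1)
      ≤ Real.exp ((‖X‖ + 1) / ((n : ℝ) + 1)) ^ (n + 1) := by
        gcongr
        rw [add_comm]
        exact Real.add_one_le_exp _
    _ = Real.exp (‖X‖ + 1) := by
        rw [← Real.exp_nat_mul]
        congr 1
        push_cast
        field_simp

/-- The derivation `A ↦ [B, A]` as a bounded operator. -/
noncomputable def commutatorCLM (B : 𝒜) : 𝒜 →L[ℂ] 𝒜 :=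
  ContinuousLinearMap.mul ℂ 𝒜 B - (ContinuousLinearMap.mul ℂ 𝒜).flip B

theorem commutatorCLM_apply (B A : 𝒜) : commutatorCLM B A = B * A - A * B := rfl

/-- The map `A ↦ X A Y` as a bounded operator. -/
noncomputable def sandwichCLM (X Y : 𝒜) : 𝒜 →L[ℂ] 𝒜 :=
  ContinuousLinearMap.mul ℂ 𝒜 X * (ContinuousLinearMap.mul ℂ 𝒜).flip Y

theorem sandwichCLM_apply (X Y A : 𝒜) : sandwichCLM X Y A = X * (A * Y) := rfl

theorem hasDerivAt_sandwichCLM_exp (B : 𝒜) :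
    HasDerivAt (fun z : ℂ => sandwichCLM (NormedSpace.exp (z • B)) (NormedSpace.exp (z • (-B))))
      (commutatorCLM B) 0 := by
  have h : ∀ C : 𝒜, HasDerivAt (fun z : ℂ => NormedSpace.exp (z • C)) C 0 := fun C => by
    simpa using hasDerivAt_exp_smul_const (𝕂 := ℂ) C (0 : ℂ)
  have h1 : HasDerivAt (fun z : ℂ => ContinuousLinearMap.mul ℂ 𝒜 (NormedSpace.exp (z • B)))
      (ContinuousLinearMap.mul ℂ 𝒜 B) 0 :=
    (ContinuousLinearMap.mul ℂ 𝒜).hasFDerivAt.comp_hasDerivAt_of_eq (x := (0 : ℂ)) (h B) rfl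
  have h2 : HasDerivAt (fun z : ℂ => (ContinuousLinearMap.mul ℂ 𝒜).flip
      (NormedSpace.exp (z • (-B)))) ((ContinuousLinearMap.mul ℂ 𝒜).flip (-B)) 0 :=
    ((ContinuousLinearMap.mul ℂ 𝒜).flip).hasFDerivAt.comp_hasDerivAt_of_eq (x := (0 : ℂ))
      (h (-B)) rfl
  have h3 := h1.mul h2
  have e : ContinuousLinearMap.mul ℂ 𝒜 B *
      (ContinuousLinearMap.mul ℂ 𝒜).flip (NormedSpace.exp ((0 : ℂ) • (-B))) +
      ContinuousLinearMap.mul ℂ 𝒜 (NormedSpace.exp ((0 : ℂ) • B)) *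
        (ContinuousLinearMap.mul ℂ 𝒜).flip (-B) = commutatorCLM B := by
    ext A
    simp [commutatorCLM_apply, sub_eq_add_neg]
  rw [e] at h3
  exact h3

/-- The conjugations by `e^{zB}` form a one-parameter group with generator `[B, ·]`. -/
theorem tendsto_commutatorCLM_pow (B : 𝒜) :
    Tendsto (fun n : ℕ => (1 + ((n : ℂ) + 1)⁻¹ • commutatorCLM B) ^ (n + 1)) atTop
      (𝓝 (sandwichCLM (NormedSpace.exp B) (NormedSpace.exp (-B)))) := by
  let _ : NormedAlgebra ℚ 𝒜 := .restrictScalars ℚ ℂ 𝒜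
  set c : ℂ → (𝒜 →L[ℂ] 𝒜) := fun z => sandwichCLM
      (NormedSpace.exp (z • B)) (NormedSpace.exp (z • (-B))) with hc
  have hne : ∀ n : ℕ, ((n : ℂ) + 1) ≠ 0 := fun n => Nat.cast_add_one_ne_zero n
  have hpow : ∀ (z : ℂ) (m : ℕ), c z ^ m = c (m * z) := by
    intro z m
    induction m with
    | zero => ext A; simp [hc, sandwichCLM_apply]
    | succ m ih =>
      rw [pow_succ', ih]
      ext A
      have e : ∀ C : 𝒜, NormedSpace.exp (((m + 1 : ℕ) * z : ℂ) • C) =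
          NormedSpace.exp (z • C) * NormedSpace.exp ((m * z : ℂ) • C) ∧
          NormedSpace.exp (((m + 1 : ℕ) * z : ℂ) • C) =
          NormedSpace.exp ((m * z : ℂ) • C) * NormedSpace.exp (z • C) := fun C => by
        have hcomm : Commute (z • C) ((m * z : ℂ) • C) :=
          ((Commute.refl C).smul_left _).smul_right _
        constructor
        · rw [← NormedSpace.exp_add_of_commute hcomm, ← add_smul]; push_cast; ring_nf
        · rw [← NormedSpace.exp_add_of_commute hcomm.symm, ← add_smul]; push_cast; ring_nf
      simp only [hc, sandwichCLM_apply]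
      rw [(e B).1, (e (-B)).2]
      change _ * (_ * (A * _) * _) = _
      noncomm_ring
  have hlim : Tendsto (fun n : ℕ => ((n : ℂ) + 1) • (c (((n : ℂ) + 1)⁻¹) - 1)) atTop
      (𝓝 (commutatorCLM B)) := by
    have h := hasDerivAt_iff_tendsto_slope_zero.1 (hasDerivAt_sandwichCLM_exp B)
    have ht : Tendsto (fun n : ℕ => ((n : ℂ) + 1)⁻¹) atTop (𝓝[≠] 0) := by
      refine tendsto_nhdsWithin_iff.2 ⟨?_, Eventually.of_forall fun n => inv_ne_zero (hne n)⟩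
      have := tendsto_one_div_add_atTop_nhds_zero_nat (𝕜 := ℂ)
      simpa using this
    have h2 := h.comp ht
    refine h2.congr fun n => ?_
    have h0 : c 0 = 1 := by
      ext A; simp [hc, sandwichCLM_apply]
    simp only [Function.comp_apply, inv_inv, zero_add]
    rw [← h0]
  have h3 := tendsto_pow_sub_pow (ContinuousLinearMap.norm_id_le) hlim
  have h4 : ∀ n : ℕ, c (((n : ℂ) + 1)⁻¹) ^ (n + 1) = sandwichCLM
      (NormedSpace.exp B) (NormedSpace.exp (-B)) := fun n => by
    rw [hpow]
    push_cast
    rw [mul_inv_cancel₀ (hne n)]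
    simp [hc]
  simp only [h4] at h3
  simpa using h3.add_const (sandwichCLM
      (NormedSpace.exp B) (NormedSpace.exp (-B)))

/-- Conjugation by an exponential is the limit of iterated small commutator steps. -/
theorem tendsto_iterate_commutator (B A : 𝒜) :
    Tendsto (fun n : ℕ =>
      (fun A => A + ((((n : ℂ) + 1)⁻¹ • B) * A - A * (((n : ℂ) + 1)⁻¹ • B)))^[n + 1] A)
      atTop (𝓝 (NormedSpace.exp B * A * NormedSpace.exp (-B))) := by
  have h := ((ContinuousLinearMap.apply ℂ 𝒜 A).continuous.tendsto _).comp
    (tendsto_commutatorCLM_pow B)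
  rw [ContinuousLinearMap.apply_apply, sandwichCLM_apply, ← mul_assoc] at h
  refine h.congr fun n => ?_
  simp only [Function.comp_apply, ContinuousLinearMap.apply_apply,
    FunLike.coe_pow_eq_iterate]
  congr 1
  ext A
  simp [commutatorCLM_apply, smul_sub]

end Conjugation

/-! ### The effective generator of a product of exponentials -/

/-- The product `∏ e^{-i α z A}` over a list of pairs `(α, A)`. -/
noncomputable def expProd {𝒜 : Type*} [NormedRing 𝒜] [NormedAlgebra ℂ 𝒜]
    (l : List (ℝ × 𝒜)) (z : ℂ) : 𝒜 :=
  (l.map fun x => NormedSpace.exp (z • (-(Complex.I * (x.1 : ℂ)) • x.2))).prod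

/-- The effective generator `G(z)` of the product `T(z) = ∏ e^{-i α z A}`, characterized by
`T' = -i G T`: the terms `α A` conjugated by the factors to their left. -/
noncomputable def effGen {𝒜 : Type*} [NormedRing 𝒜] [NormedAlgebra ℂ 𝒜] :
    List (ℝ × 𝒜) → ℂ → 𝒜
  | [], _ => 0
  | x :: l, z => (x.1 : ℂ) • x.2 + NormedSpace.exp (z • (-(Complex.I * (x.1 : ℂ)) • x.2)) *
      effGen l z * NormedSpace.exp (-(z • (-(Complex.I * (x.1 : ℂ)) • x.2)))

namespace PieceSystem

set_option linter.unusedSectionVars false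

variable {S P : Type} [DecidableEq S] [Fintype P] [DecidableEq P]
  {𝓗 : Type} [NormedAddCommGroup 𝓗] [InnerProductSpace ℂ 𝓗] [CompleteSpace 𝓗] {k : ℕ}
  {𝒮 : PieceSystem S P 𝓗 k}

theorem Majorized.iterate_add_commutator {f ν : S → ℝ} {ρ : P → ℝ} {A : 𝓗 →L[ℂ] 𝓗} {d : P → ℂ}
    {M : ℝ} (hM : 0 ≤ M) (h : 𝒮.Majorized f ν ρ A) (hf3 : ∀ i, f i ≤ 3) (m : ℕ)
    (hf1 : ∀ i, 1 ≤ f i - m * (6 * 3 ^ k * 𝒮.strength d i))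
    (hν : ∀ i, ν i + m * (2 * (3 ^ k * (k * M)) * 𝒮.strength d i) ≤ M) :
    𝒮.Majorized (fun i => f i - m * (6 * 3 ^ k * 𝒮.strength d i))
      (fun i => ν i + m * (2 * (3 ^ k * (k * M)) * 𝒮.strength d i))
      (fun p => ρ p + m * (3 ^ k * (k * M) * ‖d p‖))
      ((fun A => A + (𝒮.combo d * A - A * 𝒮.combo d))^[m] A) := by
  have hs := strength_nonneg (𝒮 := 𝒮) d
  induction m with
  | zero => simpa using h
  | succ m ih =>
    have h1 : ∀ i, 0 ≤ 6 * 3 ^ k * 𝒮.strength d i := fun i => mul_nonneg (by positivity) (hs i)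
    have h2 : ∀ i, 0 ≤ 2 * (3 ^ k * (k * M)) * 𝒮.strength d i := fun i =>
      mul_nonneg (by positivity) (hs i)
    push_cast at hf1 hν
    have ih' := ih (fun i => by have := hf1 i; have := h1 i; linarith)
      (fun i => by have := hν i; have := h2 i; linarith)
    have key := ih'.add_commutator (d := d)
      (f' := fun i => f i - (m + 1 : ℕ) * (6 * 3 ^ k * 𝒮.strength d i)) hM
      (fun i => by have := hν i; have := h2 i; linarith)
      (fun i => by push_cast; exact hf1 i)
      (fun i => by
        have := hf3 i
        have := mul_nonneg (Nat.cast_nonneg (α := ℝ) m) (h1 i)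
        linarith)
      (fun i => by push_cast; linarith)
    rw [Function.iterate_succ_apply']
    refine key.mono (fun i => ?_) fun p => ?_
    · push_cast; linarith
    · push_cast; linarith

variable (𝒮) in
/-- `A` is a limit of operators with a common majorant. -/
def LimMajorized (f ν : S → ℝ) (ρ : P → ℝ) (A : 𝓗 →L[ℂ] 𝓗) : Prop :=
  A ∈ closure {A | 𝒮.Majorized f ν ρ A}

theorem LimMajorized.add {f ν ν' : S → ℝ} {ρ ρ' : P → ℝ} {A B : 𝓗 →L[ℂ] 𝓗}
    (hA : 𝒮.Majorized f ν ρ A) (hB : 𝒮.LimMajorized f ν' ρ' B) :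
    𝒮.LimMajorized f (ν + ν') (ρ + ρ') (A + B) :=
  map_mem_closure (continuous_const.add continuous_id) hB fun _ h => hA.add h

/-- Conjugation by `e^D` with `D = ∑ d_p h_p`: the cost of the infinitely many commutators with
`D / (n + 1)` adds up to that of a single commutator with `D`. -/
theorem LimMajorized.conj_exp {f ν : S → ℝ} {ρ : P → ℝ} {A : 𝓗 →L[ℂ] 𝓗} {d : P → ℂ}
    {M : ℝ} (hM : 0 ≤ M) (h : 𝒮.LimMajorized f ν ρ A) (hf3 : ∀ i, f i ≤ 3)
    (hf1 : ∀ i, 1 ≤ f i - 6 * 3 ^ k * 𝒮.strength d i)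
    (hν : ∀ i, ν i + 2 * (3 ^ k * (k * M)) * 𝒮.strength d i ≤ M) :
    𝒮.LimMajorized (fun i => f i - 6 * 3 ^ k * 𝒮.strength d i)
      (fun i => ν i + 2 * (3 ^ k * (k * M)) * 𝒮.strength d i)
      (fun p => ρ p + 3 ^ k * (k * M) * ‖d p‖)
      (NormedSpace.exp (𝒮.combo d) * A * NormedSpace.exp (-𝒮.combo d)) := by
  have hc : Continuous fun A => NormedSpace.exp (𝒮.combo d) * A * NormedSpace.exp (-𝒮.combo d) :=
    by fun_prop
  rw [LimMajorized, ← closure_closure]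
  refine map_mem_closure (f := fun A => NormedSpace.exp (𝒮.combo d) * A *
    NormedSpace.exp (-𝒮.combo d)) hc h fun A hA => ?_
  refine mem_closure_of_tendsto (tendsto_iterate_commutator (𝒮.combo d) A)
    (Eventually.of_forall fun n => ?_)
  have hn : ‖((n : ℂ) + 1)⁻¹‖ = ((n : ℝ) + 1)⁻¹ := by
    have := Complex.norm_natCast (n + 1)
    push_cast at this
    rw [norm_inv, this]
  have hn0 : ((n : ℝ) + 1) ≠ 0 := by positivity
  have e1 : ∀ (c x : ℝ), ((n + 1 : ℕ) : ℝ) * (c * (((n : ℝ) + 1)⁻¹ * x)) = c * x := fun c x => by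
    push_cast; field_simp
  have key := Majorized.iterate_add_commutator (d := ((n : ℂ) + 1)⁻¹ • d) hM hA hf3 (n + 1)
    (fun i => by rw [strength_smul, hn, e1]; exact hf1 i)
    (fun i => by rw [strength_smul, hn, e1]; exact hν i)
  simp only [strength_smul, hn, e1, combo_smul, Pi.smul_apply, norm_smul] at key
  exact key

/-- The effective generator has a majorant that depends on the factors only through the total
strength per site and the total coefficient per piece. The site weights start at `3` and stay above
`2` as long as `|z|` is small. -/
theorem majorized_effGen (l : List (ℝ × (P → ℂ))) (z : ℂ) {M : ℝ} (hM : 0 ≤ M)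
    (hf : ∀ i, 6 * 3 ^ k * ‖z‖ * (l.map fun x => |x.1| * 𝒮.strength x.2 i).sum ≤ 1)
    (hν : ∀ i, (3 ^ k + 2 * (3 ^ k * (k * M)) * ‖z‖) *
      (l.map fun x => |x.1| * 𝒮.strength x.2 i).sum ≤ M) :
    𝒮.LimMajorized
      (fun i => 3 - 6 * 3 ^ k * ‖z‖ * (l.map fun x => |x.1| * 𝒮.strength x.2 i).sum)
      (fun i => (3 ^ k + 2 * (3 ^ k * (k * M)) * ‖z‖) *
        (l.map fun x => |x.1| * 𝒮.strength x.2 i).sum)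
      (fun p => (3 ^ k + 3 ^ k * (k * M) * ‖z‖) * (l.map fun x => |x.1| * ‖x.2 p‖).sum)
      (effGen (l.map fun x => (x.1, 𝒮.combo x.2)) z) := by
  induction l with
  | nil =>
    refine subset_closure (majorized_zero (fun i => ?_) fun p => ?_) <;> simp
  | cons x l ih =>
    obtain ⟨α, d⟩ := x
    simp only [List.map_cons, List.sum_cons] at hf hν ⊢
    have hs : ∀ i, 0 ≤ |α| * 𝒮.strength d i := fun i =>
      mul_nonneg (abs_nonneg _) (strength_nonneg d i)
    have hl : ∀ i, 0 ≤ (l.map fun x => |x.1| * 𝒮.strength x.2 i).sum := fun i =>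
      List.sum_nonneg fun y hy => by
        obtain ⟨x, -, rfl⟩ := List.mem_map.1 hy
        exact mul_nonneg (abs_nonneg _) (strength_nonneg x.2 i)
    have hc1 : 0 ≤ 6 * 3 ^ k * ‖z‖ := by positivity
    have hc2 : 0 ≤ 3 ^ k + 2 * (3 ^ k * (k * M)) * ‖z‖ := by positivity
    have hc3 : (0 : ℝ) ≤ 3 ^ k := by positivity
    have h1 := ih
      (fun i => by have := hf i; have := mul_nonneg hc1 (hs i); linarith)
      (fun i => by have := hν i; have := mul_nonneg hc2 (hs i); linarith)
    have hα : ‖z * -(Complex.I * (α : ℂ))‖ = ‖z‖ * |α| := by simp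
    have hst : ∀ i, 𝒮.strength ((z * -(Complex.I * (α : ℂ))) • d) i =
        ‖z‖ * |α| * 𝒮.strength d i := fun i => by rw [strength_smul, hα]
    have h2 := LimMajorized.conj_exp (d := (z * -(Complex.I * (α : ℂ))) • d) hM h1
      (fun i => by have := mul_nonneg hc1 (hl i); linarith)
      (fun i => by rw [hst]; have := hf i; linarith)
      (fun i => by
        rw [hst]
        have := hν i
        have := mul_nonneg hc3 (hs i)
        linarith)
    have h3 := LimMajorized.add (majorized_combo (𝒮 := 𝒮) (d := (α : ℂ) • d)
      (fun i => by rw [hst]; have := hf i; linarith)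
      (fun i => by
        rw [hst]
        have := mul_nonneg hc1 (hl i)
        have := mul_nonneg hc1 (hs i)
        linarith)) h2
    rw [combo_smul, combo_smul, mul_smul _ _ (𝒮.combo d)] at h3
    rw [effGen]
    have ef : ∀ i, 3 - 6 * 3 ^ k * ‖z‖ * (l.map fun x => |x.1| * 𝒮.strength x.2 i).sum -
        6 * 3 ^ k * 𝒮.strength ((z * -(Complex.I * (α : ℂ))) • d) i =
        3 - 6 * 3 ^ k * ‖z‖ * (|α| * 𝒮.strength d i +
          (l.map fun x => |x.1| * 𝒮.strength x.2 i).sum) := fun i => by rw [hst]; ring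
    simp only [ef] at h3
    refine closure_mono (fun A hA => ?_) h3
    refine Majorized.mono hA (fun i => le_of_eq ?_) fun p => le_of_eq ?_
    · simp only [Pi.add_apply, strength_smul, hα, Complex.norm_real, Real.norm_eq_abs]
      ring
    · simp only [Pi.add_apply, Pi.smul_apply, norm_smul, hα, Complex.norm_real, Real.norm_eq_abs]
      ring

/-- The effective generator at complex times is bounded by the Hamiltonian `H = ∑ h_p`: the
right-hand side is a combination of `‖H ψ‖²` and the energy `⟨ψ, H ψ⟩ = ∑ ‖c_p ψ‖²`. -/
theorem norm_effGen_apply_sq_le (l : List (ℝ × (P → ℂ))) (z : ℂ) {M β G : ℝ} (hM : 0 ≤ M)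
    (hβ : 0 ≤ β) (hG0 : 0 ≤ G)
    (hf : ∀ i, 6 * 3 ^ k * ‖z‖ * (l.map fun x => |x.1| * 𝒮.strength x.2 i).sum ≤ 1)
    (hν : ∀ i, (3 ^ k + 2 * (3 ^ k * (k * M)) * ‖z‖) *
      (l.map fun x => |x.1| * 𝒮.strength x.2 i).sum ≤ M)
    (hρ : ∀ p, (3 ^ k + 3 ^ k * (k * M) * ‖z‖) * (l.map fun x => |x.1| * ‖x.2 p‖).sum ≤ β)
    (hG : ∀ i, ∑ p, (if i ∈ 𝒮.supp p then 𝒮.wt p else 0) ≤ G) (ψ : 𝓗) :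
    ‖effGen (l.map fun x => (x.1, 𝒮.combo x.2)) z ψ‖ ^ 2 ≤ β ^ 2 * ‖∑ p, 𝒮.piece p ψ‖ ^ 2 +
      (β ^ 2 * (k * G) + M * β) * ∑ p, ‖𝒮.root p ψ‖ ^ 2 := by
  have h := majorized_effGen (𝒮 := 𝒮) l z hM hf hν
  have hclosed : IsClosed {A : 𝓗 →L[ℂ] 𝓗 | ‖A ψ‖ ^ 2 ≤ β ^ 2 * ‖∑ p, 𝒮.piece p ψ‖ ^ 2 +
      (β ^ 2 * (k * G) + M * β) * ∑ p, ‖𝒮.root p ψ‖ ^ 2} :=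
    isClosed_le (by fun_prop) continuous_const
  refine closure_minimal (fun A hA => ?_) hclosed h
  exact Majorized.norm_apply_sq_le hA (fun i => by have := hf i; linarith) hM hβ hG0 hν hρ hG ψ

end PieceSystem

/-! ### From the effective generator to the Trotter error -/

/-- An analytic function of order `t ^ n` along the real axis vanishes to order `n`. -/
theorem natCast_le_analyticOrderAt_of_isBigO_real {E : Type*} [NormedAddCommGroup E]
    [NormedSpace ℂ E] {f : ℂ → E} (hf : AnalyticAt ℂ f 0) {n : ℕ}
    (h : (fun t : ℝ => f t) =O[𝓝 0] fun t : ℝ => t ^ n) : n ≤ analyticOrderAt f 0 := by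
  by_contra hlt
  rw [not_le] at hlt
  obtain ⟨m, hm⟩ := ENat.ne_top_iff_exists.1 hlt.ne_top
  rw [← hm, Nat.cast_lt] at hlt
  obtain ⟨g, hg, hg0, hfg⟩ := hf.analyticOrderAt_eq_natCast.1 hm.symm
  have hre : Tendsto (fun t : ℝ => (t : ℂ)) (𝓝[≠] 0) (𝓝 0) :=
    (Complex.continuous_ofReal.tendsto' 0 0 (by simp)).mono_left nhdsWithin_le_nhds
  have hlim : Tendsto (fun t : ℝ => g t) (𝓝[≠] 0) (𝓝 (g 0)) := hg.continuousAt.tendsto.comp hre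
  refine hg0 (tendsto_nhds_unique hlim ?_)
  obtain ⟨C, hC⟩ := h.bound
  have hz : Tendsto (fun t : ℝ => C * ‖t‖ ^ (n - m)) (𝓝[≠] 0) (𝓝 0) := by
    have : ContinuousAt (fun t : ℝ => C * ‖t‖ ^ (n - m)) 0 := by fun_prop
    have h2 := this.tendsto.mono_left (nhdsWithin_le_nhds (s := {0}ᶜ))
    simpa [Nat.sub_ne_zero_of_lt hlt] using h2
  refine squeeze_zero_norm' ?_ hz
  filter_upwards [hre.eventually hfg, hC.filter_mono nhdsWithin_le_nhds, self_mem_nhdsWithin]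
    with t h1 h2 h3
  have ht : 0 < ‖t‖ := norm_pos_iff.2 h3
  rw [h1, norm_smul, norm_pow, sub_zero, Complex.norm_real, norm_pow] at h2
  have e : ‖t‖ ^ n = ‖t‖ ^ m * ‖t‖ ^ (n - m) := by rw [← pow_add, Nat.add_sub_of_le hlt.le]
  rw [e, mul_left_comm] at h2
  exact le_of_mul_le_mul_left h2 (pow_pos ht m)

theorem hasDerivAt_comp_ofReal {E : Type*} [NormedAddCommGroup E] [NormedSpace ℂ E] {f : ℂ → E}
    {f' : E} {t : ℝ} (h : HasDerivAt f f' t) : HasDerivAt (fun t : ℝ => f t) f' t := by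
  have h1 := HasDerivAt.scomp t h Complex.ofRealCLM.hasDerivAt
  simpa using! h1

section Trotter

set_option linter.unusedSectionVars false

variable {𝒜 : Type*} [NormedRing 𝒜] [NormedAlgebra ℂ 𝒜] [CompleteSpace 𝒜]

/-- The defining property `T' = -i G T` of the effective generator. -/
theorem hasDerivAt_expProd (l : List (ℝ × 𝒜)) (z : ℂ) :
    HasDerivAt (expProd l) (-(Complex.I • (effGen l z * expProd l z))) z := by
  let _ : NormedAlgebra ℚ 𝒜 := .restrictScalars ℚ ℂ 𝒜
  induction l with
  | nil =>
    have : expProd ([] : List (ℝ × 𝒜)) = fun _ => 1 := by ext z; simp [expProd]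
    rw [this]
    simpa [effGen] using hasDerivAt_const z (1 : 𝒜)
  | cons x l ih =>
    set a := -(Complex.I * (x.1 : ℂ)) • x.2 with ha
    have h1 := (hasDerivAt_exp_smul_const' (𝕂 := ℂ) a z).mul ih
    have e : expProd (x :: l) = (fun z : ℂ => NormedSpace.exp (z • a)) * expProd l := by
      ext z; simp [expProd, ha]
    have einv : NormedSpace.exp (-(z • a)) * NormedSpace.exp (z • a) = 1 := by
      rw [← NormedSpace.exp_add_of_commute (Commute.refl _).neg_left]; simp
    rw [e]
    refine h1.congr_deriv ?_
    simp only [effGen, ← ha, Pi.mul_apply]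
    have e2 : ((x.1 : ℂ) • x.2 +
          NormedSpace.exp (z • a) * effGen l z * NormedSpace.exp (-(z • a))) *
        (NormedSpace.exp (z • a) * expProd l z) = ((x.1 : ℂ) • x.2) * NormedSpace.exp (z • a) *
          expProd l z + NormedSpace.exp (z • a) * (effGen l z * expProd l z) := by
      calc _ = ((x.1 : ℂ) • x.2) * NormedSpace.exp (z • a) * expProd l z +
          NormedSpace.exp (z • a) * effGen l z * (NormedSpace.exp (-(z • a)) *
            NormedSpace.exp (z • a)) * expProd l z := by simp only [add_mul, mul_assoc]
        _ = _ := by rw [einv, mul_one, mul_assoc (NormedSpace.exp (z • a))]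
    rw [e2, smul_add, neg_add, ha]
    simp only [neg_smul, neg_mul, mul_neg, smul_mul_assoc, mul_smul_comm, mul_smul]

theorem differentiable_effGen (l : List (ℝ × 𝒜)) : Differentiable ℂ (effGen l) := by
  induction l with
  | nil => exact differentiable_const (0 : 𝒜)
  | cons x l ih =>
    set a := -(Complex.I * (x.1 : ℂ)) • x.2 with ha
    have h1 : Differentiable ℂ fun z : ℂ => NormedSpace.exp (z • a) := fun z =>
      (hasDerivAt_exp_smul_const (𝕂 := ℂ) a z).differentiableAt
    have h2 : Differentiable ℂ fun z : ℂ => NormedSpace.exp (-(z • a)) := fun z => by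
      have := (hasDerivAt_exp_smul_const (𝕂 := ℂ) (-a) z).differentiableAt
      simpa using this
    exact ((h1.mul ih).mul h2).const_add ((x.1 : ℂ) • x.2)

theorem expProd_zero (l : List (ℝ × 𝒜)) : expProd l 0 = 1 := by
  simp [expProd]

/-- The order condition makes the effective generator agree with `H` up to order `z ^ p`. -/
theorem effGen_sub_isBigO (l : List (ℝ × 𝒜)) (H : 𝒜) {p : ℕ}
    (h : (fun t : ℝ => expProd l t - NormedSpace.exp ((t : ℂ) • (-Complex.I • H)))
      =O[𝓝 0] fun t : ℝ => t ^ (p + 1)) :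
    (fun z : ℂ => effGen l z - H) =O[𝓝 0] fun z : ℂ => z ^ p := by
  set U : ℂ → 𝒜 := fun z => NormedSpace.exp (z • (-Complex.I • H)) with hU
  set f : ℂ → 𝒜 := fun z => expProd l z - U z with hf
  have hU' : ∀ z, HasDerivAt U (-(Complex.I • (H * U z))) z := fun z => by
    refine (hasDerivAt_exp_smul_const' (𝕂 := ℂ) (-Complex.I • H) z).congr_deriv ?_
    rw [neg_smul, neg_mul, smul_mul_assoc, hU, neg_smul]
  have hf' : ∀ z, HasDerivAt f (-(Complex.I • (effGen l z * expProd l z)) -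
      -(Complex.I • (H * U z))) z := fun z => (hasDerivAt_expProd l z).sub (hU' z)
  have hfa : AnalyticAt ℂ f 0 :=
    Differentiable.analyticAt (fun z => (hf' z).differentiableAt) 0
  obtain ⟨g, hg, hfg⟩ := (natCast_le_analyticOrderAt hfa).1
    (natCast_le_analyticOrderAt_of_isBigO_real hfa h)
  simp only [sub_zero] at hfg
  replace hfg : f =ᶠ[𝓝 0] fun z => z ^ (p + 1) • g z := hfg
  have hgO : g =O[𝓝 0] fun _ => (1 : ℂ) := hg.continuousAt.tendsto.isBigO_one ℂ
  have hg'O : deriv g =O[𝓝 0] fun _ => (1 : ℂ) := hg.deriv.continuousAt.tendsto.isBigO_one ℂ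
  have hzO : (fun z : ℂ => z) =O[𝓝 0] fun _ => (1 : ℂ) :=
    (continuous_id.tendsto (0 : ℂ)).isBigO_one ℂ
  have hpow : (fun z : ℂ => z ^ (p + 1)) =O[𝓝 0] fun z : ℂ => z ^ p := by
    simpa [pow_succ] using (isBigO_refl (fun z : ℂ => z ^ p) (𝓝 0)).mul hzO
  have hfO : f =O[𝓝 0] fun z : ℂ => z ^ p := by
    refine hfg.trans_isBigO ?_
    simpa using hpow.smul hgO
  have hf'O : (fun z => -(Complex.I • (effGen l z * expProd l z)) -
      -(Complex.I • (H * U z))) =O[𝓝 0] fun z : ℂ => z ^ p := by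
    have hev : (fun z => -(Complex.I • (effGen l z * expProd l z)) - -(Complex.I • (H * U z)))
        =ᶠ[𝓝 0] fun z => z ^ (p + 1) • deriv g z + (((p + 1 : ℕ) : ℂ) * z ^ p) • g z := by
      filter_upwards [hfg.eventually_nhds, hg.eventually_analyticAt] with z hz hgz
      have h1 := (hasDerivAt_pow (p + 1) z).smul hgz.differentiableAt.hasDerivAt
      have h2 : HasDerivAt f _ z := h1.congr_of_eventuallyEq hz
      simpa using (hf' z).unique h2
    refine hev.trans_isBigO (IsBigO.add ?_ ?_)
    · simpa using hpow.smul hg'O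
    · simpa using ((isBigO_refl (fun z : ℂ => z ^ p) (𝓝 0)).const_mul_left ((p + 1 : ℕ) : ℂ)).smul
        hgO
  have hmul : (fun z => (effGen l z - H) * expProd l z) =O[𝓝 0] fun z : ℂ => z ^ p := by
    have h3 : (fun z => (effGen l z - H) * expProd l z) = fun z =>
        Complex.I • ((-(Complex.I • (effGen l z * expProd l z)) - -(Complex.I • (H * U z))) +
          Complex.I • (H * f z)) := by
      ext z
      simp only [hf, mul_sub, sub_mul, smul_add, smul_sub, smul_neg, smul_smul, Complex.I_mul_I,
        neg_smul, one_smul]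
      abel
    rw [h3]
    have h4 : (fun z => H * f z) =O[𝓝 0] fun z : ℂ => z ^ p := by
      simpa using (isBigO_const_const H (one_ne_zero (α := ℂ)) (𝓝 0)).mul hfO
    have h5 : (fun z => Complex.I • (H * f z)) =O[𝓝 0] fun z : ℂ => z ^ p :=
      IsBigO.const_smul_left h4 Complex.I
    exact IsBigO.const_smul_left (hf'O.add h5) Complex.I
  -- Since `T(0) = 1`, right multiplication by `T(z)` is bounded below near `z = 0`.
  have hT : ∀ᶠ z in 𝓝 (0 : ℂ), ‖1 - expProd l z‖ ≤ 1 / 2 := by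
    have hc : Tendsto (fun z => ‖1 - expProd l z‖) (𝓝 0) (𝓝 0) := by
      have := (continuous_const.sub (continuous_iff_continuousAt.2 fun z =>
        (hasDerivAt_expProd l z).continuousAt)).norm.tendsto' (0 : ℂ) (0 : ℝ)
        (show ‖(1 : 𝒜) - expProd l 0‖ = 0 by simp [expProd_zero])
      exact this
    exact hc.eventually_le_const (by norm_num)
  refine IsBigO.trans ?_ hmul
  refine IsBigO.of_bound 2 ?_
  filter_upwards [hT] with z hz
  have e : effGen l z - H = (effGen l z - H) * expProd l z +
      (effGen l z - H) * (1 - expProd l z) := by noncomm_ring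
  have h4 := norm_add_le ((effGen l z - H) * expProd l z) ((effGen l z - H) * (1 - expProd l z))
  rw [← e] at h4
  have h5 := (norm_mul_le (effGen l z - H) (1 - expProd l z)).trans
    (mul_le_mul_of_nonneg_left hz (norm_nonneg _))
  linarith

/-- The Schwarz lemma turns a uniform bound on the effective generator on low-energy vectors into a
bound of order `|z| ^ p`. -/
theorem norm_effGen_sub_mul_le (l : List (ℝ × 𝒜)) (H Q : 𝒜) {p : ℕ} (hp : 1 ≤ p) {B R : ℝ}
    (h : (fun z : ℂ => effGen l z - H) =O[𝓝 0] fun z : ℂ => z ^ p)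
    (hB : ∀ z : ℂ, ‖z‖ < R → ‖(effGen l z - H) * Q‖ ≤ B) {z : ℂ} (hz : ‖z‖ < R) :
    ‖(effGen l z - H) * Q‖ ≤ B * (‖z‖ / R) ^ p := by
  obtain ⟨q, rfl⟩ := Nat.exists_eq_succ_of_ne_zero (Nat.one_le_iff_ne_zero.1 hp)
  have h0 : effGen l 0 - H = 0 := by
    obtain ⟨C, hC⟩ := h.bound
    simpa using hC.self_of_nhds
  have hF0 : (effGen l 0 - H) * Q = 0 := by rw [h0, zero_mul]
  have hd : Differentiable ℂ fun z => (effGen l z - H) * Q :=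
    ((differentiable_effGen l).sub_const H).mul_const Q
  have hlit : (fun z : ℂ => (effGen l z - H) * Q) =o[𝓝 0] fun z : ℂ => z ^ q := by
    have h1 : (fun z : ℂ => (effGen l z - H) * Q) =O[𝓝 0] fun z : ℂ => z ^ (q + 1) := by
      simpa using h.mul (isBigO_const_const Q (one_ne_zero (α := ℂ)) (𝓝 0))
    refine h1.trans_isLittleO ?_
    exact isLittleO_pow_pow (Nat.lt_succ_self q)
  have key := Complex.dist_le_mul_div_pow_of_mapsTo_ball_of_isLittleO (c := (0 : ℂ)) (R₁ := R)
    (R₂ := B) (n := q) (f := fun z => (effGen l z - H) * Q) hd.differentiableOn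
    (fun w hw => by
      rw [Metric.mem_closedBall, dist_eq_norm, hF0, sub_zero]
      exact hB w (by simpa using hw))
    (by simpa [hF0] using hlit.norm_right) (z := z) (by simpa using hz)
  simpa [hF0, dist_eq_norm] using key

variable [StarRing 𝒜] [CStarRing 𝒜] [StarModule ℂ 𝒜]

theorem star_exp_ofReal (A : 𝒜) (hA : IsSelfAdjoint A) (α t : ℝ) :
    star (NormedSpace.exp ((t : ℂ) • (-(Complex.I * (α : ℂ)) • A))) =
      NormedSpace.exp (-((t : ℂ) • (-(Complex.I * (α : ℂ)) • A))) := by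
  rw [NormedSpace.star_exp]
  congr 1
  simp [hA.star_eq]

theorem expProd_mem_unitary (l : List (ℝ × 𝒜)) (hl : ∀ x ∈ l, IsSelfAdjoint x.2) (t : ℝ) :
    expProd l t ∈ unitary 𝒜 := by
  let _ : NormedAlgebra ℚ 𝒜 := .restrictScalars ℚ ℂ 𝒜
  refine list_prod_mem fun y hy => ?_
  obtain ⟨x, hx, rfl⟩ := List.mem_map.1 hy
  refine NormedSpace.exp_mem_unitary_of_mem_skewAdjoint ?_
  rw [skewAdjoint.mem_iff]
  simp [(hl x hx).star_eq]

theorem isSelfAdjoint_effGen (l : List (ℝ × 𝒜)) (hl : ∀ x ∈ l, IsSelfAdjoint x.2) (t : ℝ) :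
    IsSelfAdjoint (effGen l (t : ℂ)) := by
  induction l with
  | nil => exact IsSelfAdjoint.zero 𝒜
  | cons x l ih =>
    have hx := hl x List.mem_cons_self
    have ih' := ih fun y hy => hl y (List.mem_cons_of_mem x hy)
    have h1 := star_exp_ofReal x.2 hx x.1 t
    have h2 := congrArg star h1
    rw [star_star] at h2
    rw [IsSelfAdjoint, effGen, star_add, star_smul, hx.star_eq, star_mul, star_mul, h1, ← h2,
      ih'.star_eq]
    simp [mul_assoc]

theorem norm_le_one_of_star_mul_self {A : 𝒜} (h : star A * A = 1) : ‖A‖ ≤ 1 := by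
  have h1 := CStarRing.norm_star_mul_self (x := A)
  have h2 := CStarRing.norm_star_mul_self (x := (1 : 𝒜))
  rw [h] at h1
  simp only [star_one, mul_one] at h2
  have h3 : ‖(1 : 𝒜)‖ ≤ 1 := by nlinarith [norm_nonneg (1 : 𝒜)]
  nlinarith [norm_nonneg A]

/-- The error of one Trotter step on the range of a projection `Q` commuting with `H`.  As the exact
evolution preserves this range, only the difference `G - H` restricted to it enters. -/
theorem norm_exp_sub_expProd_mul_le (l : List (ℝ × 𝒜)) (hl : ∀ x ∈ l, IsSelfAdjoint x.2) {H Q : 𝒜}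
    (hH : IsSelfAdjoint H) (hQ : Commute H Q) {D s : ℝ} (hs : 0 ≤ s)
    (hD : ∀ τ : ℝ, 0 ≤ τ → τ < s → ‖(effGen l (τ : ℂ) - H) * Q‖ ≤ D) :
    ‖(NormedSpace.exp ((s : ℂ) • (-Complex.I • H)) - expProd l s) * Q‖ ≤ s * D := by
  set U : ℂ → 𝒜 := fun z => NormedSpace.exp (z • (-Complex.I • H)) with hU
  have hUeq : ∀ z, U z = expProd [((1 : ℝ), H)] z := fun z => by simp [expProd, hU]
  have hU1 : ∀ t : ℝ, ‖U t‖ ≤ 1 := fun t => by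
    rw [hUeq]
    exact norm_le_one_of_star_mul_self
      (expProd_mem_unitary [((1 : ℝ), H)] (by simpa using hH) t).1
  have hT1 : ∀ t : ℝ, ‖expProd l t‖ ≤ 1 := fun t =>
    norm_le_one_of_star_mul_self (expProd_mem_unitary l hl t).1
  have hUQ : ∀ z, Commute (U z) Q := fun z =>
    ((hQ.smul_left _).smul_left _).exp_left
  have hUd : ∀ t : ℝ, HasDerivAt (fun t : ℝ => U t) (-(Complex.I • (H * U t))) t := fun t => by
    refine hasDerivAt_comp_ofReal (f := U) ?_
    refine (hasDerivAt_exp_smul_const' (𝕂 := ℂ) (-Complex.I • H) (t : ℂ)).congr_deriv ?_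
    rw [neg_smul, neg_mul, smul_mul_assoc, hU, neg_smul]
  have hTd : ∀ t : ℝ, HasDerivAt (fun t : ℝ => star (expProd l t))
      (star (-(Complex.I • (effGen l (t : ℂ) * expProd l t)))) t := fun t =>
    (hasDerivAt_comp_ofReal (hasDerivAt_expProd l (t : ℂ))).star
  -- Differentiate the interaction picture `T(t)† U(t) Q`, which is constant if `G = H`.
  have hK : ∀ t : ℝ, HasDerivAt (fun t : ℝ => star (expProd l t) * U t * Q)
      (Complex.I • (star (expProd l t) * ((effGen l (t : ℂ) - H) * Q) * U t)) t := fun t => by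
    refine (((hTd t).mul (hUd t)).mul_const Q).congr_deriv ?_
    rw [star_neg, star_smul, star_mul, (isSelfAdjoint_effGen l hl t).star_eq]
    have e : (effGen l (t : ℂ) - H) * Q * U t = (effGen l (t : ℂ) - H) * U t * Q := by
      rw [mul_assoc, ← (hUQ t).eq, mul_assoc]
    rw [mul_assoc (star _) _ (U t), e]
    simp only [RCLike.star_def, Complex.conj_I, neg_smul, neg_neg, mul_neg, add_mul, sub_mul,
      mul_sub, smul_sub, smul_mul_assoc, mul_smul_comm, neg_mul, mul_assoc]
    abel
  have hbound : ∀ t ∈ Set.Ico (0 : ℝ) s,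
      ‖Complex.I • (star (expProd l t) * ((effGen l (t : ℂ) - H) * Q) * U t)‖ ≤ D := by
    intro t ht
    rw [norm_smul, Complex.norm_I, one_mul]
    have h1 : ‖star (expProd l t)‖ ≤ 1 := by rw [norm_star]; exact hT1 t
    have h2 := hD t ht.1 ht.2
    calc _ ≤ ‖star (expProd l t)‖ * ‖(effGen l (t : ℂ) - H) * Q‖ * ‖U t‖ :=
          (norm_mul_le _ _).trans (mul_le_mul_of_nonneg_right (norm_mul_le _ _) (norm_nonneg _))
      _ ≤ 1 * D * 1 := by
          gcongr
          · rw [one_mul]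
            exact (norm_nonneg _).trans h2
          · exact hU1 t
      _ = D := by ring
  have key := norm_image_sub_le_of_norm_deriv_le_segment' (a := (0 : ℝ)) (b := s)
    (fun t _ => (hK t).hasDerivWithinAt) hbound s ⟨hs, le_rfl⟩
  have hU0 : U 0 = 1 := by simp [hU]
  have e : (U s - expProd l s) * Q =
      expProd l s * (star (expProd l s) * U s * Q - star (expProd l 0) * U 0 * Q) := by
    have hTT := (expProd_mem_unitary l hl s).2
    rw [hU0, expProd_zero, star_one, one_mul, one_mul, mul_sub, ← mul_assoc, ← mul_assoc, hTT,
      one_mul, sub_mul]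
  simp only [Complex.ofReal_zero, sub_zero] at key
  change ‖(U s - expProd l s) * Q‖ ≤ _
  rw [e]
  refine (norm_mul_le _ _).trans ?_
  calc _ ≤ 1 * (D * s) := mul_le_mul (hT1 s) key (norm_nonneg _) zero_le_one
    _ = s * D := by ring

end Trotter

/-! ### Locality of qubit operators -/

section Matrix

variable {n : Type*} [Fintype n] [DecidableEq n]

theorem norm_apply_le_l2_opNorm (A : Matrix n n ℂ) (i j : n) : ‖A i j‖ ≤ ‖A‖ := by
  have h1 : (Matrix.toEuclideanCLM (n := n) (𝕜 := ℂ) A (EuclideanSpace.single j 1)) i = A i j := by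
    simp [Matrix.ofLp_toEuclideanCLM]
  rw [← h1, ← Matrix.l2_opNorm_toEuclideanCLM A]
  refine (PiLp.norm_apply_le _ i).trans ?_
  refine (ContinuousLinearMap.le_opNorm _ _).trans ?_
  simp

/-- Unlike the norm, the trace is additive over a decomposition into positive parts. -/
theorem Matrix.PosSemidef.norm_le_re_trace {B : Matrix n n ℂ} (hB : B.PosSemidef) :
    ‖B‖ ≤ RCLike.re B.trace := by
  have h0 := hB.eigenvalues_nonneg
  have hsp := hB.1.spectral_theorem
  rw [Unitary.conjStarAlgAut_apply] at hsp
  have hn : ‖B‖ = ‖Matrix.diagonal ((RCLike.ofReal : ℝ → ℂ) ∘ hB.1.eigenvalues)‖ := by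
    conv_lhs => rw [hsp]
    rw [← Unitary.coe_star, CStarRing.norm_mul_coe_unitary, CStarRing.norm_coe_unitary_mul]
  rw [hn, Matrix.l2_opNorm_diagonal, hB.1.trace_eq_sum_eigenvalues, map_sum]
  have hs : 0 ≤ ∑ i, hB.1.eigenvalues i := Finset.sum_nonneg fun i _ => h0 i
  simp only [RCLike.ofReal_re]
  refine (pi_norm_le_iff_of_nonneg hs).2 fun i => ?_
  simp only [Function.comp_apply, RCLike.norm_ofReal, abs_of_nonneg (h0 i)]
  exact Finset.single_le_sum (fun i _ => h0 i) (Finset.mem_univ i)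

end Matrix

/-- The operator `B ⊗ 1` on `N` qubits, for `B` acting on the qubits in `X`. -/
def extendOp {N : ℕ} (X : Finset (Fin N)) (B : Matrix (X → Fin 2) (X → Fin 2) ℂ) : QubitOp N :=
  fun σ τ => if ∀ i, i ∉ X → σ i = τ i then B (fun i => σ i) (fun i => τ i) else 0

/-- The configuration that equals `ρ` on `X` and `σ` elsewhere. -/
def glue {N : ℕ} (X : Finset (Fin N)) (ρ : X → Fin 2) (σ : Fin N → Fin 2) : Fin N → Fin 2 :=
  fun i => if h : i ∈ X then ρ ⟨i, h⟩ else σ i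

/-- The restriction of an operator to the qubits in `X`, the others being fixed to `0`. -/
def restrictOp {N : ℕ} (X : Finset (Fin N)) (A : QubitOp N) :
    Matrix (X → Fin 2) (X → Fin 2) ℂ :=
  A.submatrix (fun ρ => glue X ρ 0) (fun ρ => glue X ρ 0)

section Locality

variable {N : ℕ} {X Y : Finset (Fin N)}

theorem restrictOp_extendOp (B : Matrix (X → Fin 2) (X → Fin 2) ℂ) :
    restrictOp X (extendOp X B) = B := by
  ext ρ ρ'
  have h1 : ∀ i, i ∉ X → glue X ρ 0 i = glue X ρ' 0 i := fun i hi => by simp [glue, hi]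
  have h2 : ∀ ρ : X → Fin 2, (fun i : X => glue X ρ 0 i) = ρ := fun ρ => by
    ext i; simp [glue]
  simp only [restrictOp, Matrix.submatrix_apply, extendOp]
  rw [if_pos h1, h2, h2]

theorem ActsOn.extendOp_restrictOp {A : QubitOp N} (h : ActsOn A X) :
    extendOp X (restrictOp X A) = A := by
  obtain ⟨B, hB⟩ := h
  have hA : A = extendOp X B := by
    ext σ τ; exact hB σ τ
  rw [hA, restrictOp_extendOp]

theorem extendOp_mul (B C : Matrix (X → Fin 2) (X → Fin 2) ℂ) :
    extendOp X (B * C) = extendOp X B * extendOp X C := by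
  ext σ τ
  rw [Matrix.mul_apply]
  -- Only the configurations that agree with `σ` outside `X` contribute.
  have hinj : Function.Injective fun ρ : X → Fin 2 => glue X ρ σ := fun ρ ρ' h => by
    ext i
    have := congrFun h i
    simpa [glue] using congrArg Fin.val this
  have hsum : ∑ κ, extendOp X B σ κ * extendOp X C κ τ =
      ∑ ρ : X → Fin 2, extendOp X B σ (glue X ρ σ) * extendOp X C (glue X ρ σ) τ := by
    refine Eq.trans ?_ (Finset.sum_map Finset.univ ⟨_, hinj⟩
      fun κ => extendOp X B σ κ * extendOp X C κ τ)
    refine (Finset.sum_subset (Finset.subset_univ _) fun κ _ hκ => ?_).symm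
    have : ¬ ∀ i, i ∉ X → σ i = κ i := fun h => hκ <| by
      simp only [Finset.mem_map, Finset.mem_univ, true_and, Function.Embedding.coeFn_mk]
      refine ⟨fun i => κ i, ?_⟩
      ext i
      by_cases hi : i ∈ X
      · simp [glue, hi]
      · simp [glue, hi, h i hi]
    simp [extendOp, this]
  have h1 : ∀ ρ : X → Fin 2, ∀ i, i ∉ X → σ i = glue X ρ σ i := fun ρ i hi => by
    simp [glue, hi]
  have h2 : ∀ ρ : X → Fin 2, (fun i : X => glue X ρ σ i) = ρ := fun ρ => by
    ext i; simp [glue]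
  have h3 : ∀ ρ : X → Fin 2,
      (∀ i, i ∉ X → glue X ρ σ i = τ i) ↔ (∀ i, i ∉ X → σ i = τ i) := fun ρ =>
    forall₂_congr fun i hi => by rw [← h1 ρ i hi]
  rw [hsum]
  simp only [extendOp, if_pos (h1 _), h2, h3]
  split_ifs
  · rw [Matrix.mul_apply]
  · simp

theorem extendOp_conjTranspose (B : Matrix (X → Fin 2) (X → Fin 2) ℂ) :
    extendOp X B.conjTranspose = (extendOp X B).conjTranspose := by
  ext σ τ
  simp only [extendOp, Matrix.conjTranspose_apply, eq_comm (a := τ _)]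
  split_ifs <;> simp

theorem extendOp_mul_apply_of_disjoint (h : Disjoint X Y)
    (B : Matrix (X → Fin 2) (X → Fin 2) ℂ) (C : Matrix (Y → Fin 2) (Y → Fin 2) ℂ)
    (σ τ : Fin N → Fin 2) :
    (extendOp X B * extendOp Y C) σ τ = if ∀ i, i ∉ X → i ∉ Y → σ i = τ i then
      B (fun i => σ i) (fun i => τ i) * C (fun i => σ i) (fun i => τ i) else 0 := by
  rw [Matrix.mul_apply, Finset.sum_eq_single (glue X (fun i => τ i) σ)]
  · have h1 : ∀ i, i ∉ X → σ i = glue X (fun i => τ i) σ i := fun i hi => by simp [glue, hi]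
    have h2 : (fun i : X => glue X (fun i => τ i) σ i) = fun i : X => τ i := by
      ext i; simp [glue]
    have h3 : (fun i : Y => glue X (fun i => τ i) σ i) = fun i : Y => σ i := by
      ext i
      rw [← h1 i (Finset.disjoint_right.1 h i.2)]
    have h4 : (∀ i, i ∉ Y → glue X (fun i => τ i) σ i = τ i) ↔
        ∀ i, i ∉ X → i ∉ Y → σ i = τ i := by
      refine forall_congr' fun i => ?_
      by_cases hi : i ∈ X
      · simp [glue, hi]
      · simp [glue, hi]
    simp only [extendOp, if_pos h1, h2, h3, h4]
    split_ifs <;> simp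
  · intro κ _ hκ
    by_cases h1 : ∀ i, i ∉ X → σ i = κ i
    · by_cases h2 : ∀ i, i ∉ Y → κ i = τ i
      · refine absurd ?_ hκ
        ext i
        by_cases hi : i ∈ X
        · simp [glue, hi, h2 i (Finset.disjoint_left.1 h hi)]
        · simp [glue, hi, h1 i hi]
      · simp [extendOp, h2]
    · simp [extendOp, h1]
  · simp

theorem commute_extendOp_of_disjoint (h : Disjoint X Y)
    (B : Matrix (X → Fin 2) (X → Fin 2) ℂ) (C : Matrix (Y → Fin 2) (Y → Fin 2) ℂ) :
    Commute (extendOp X B) (extendOp Y C) := by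
  ext σ τ
  rw [extendOp_mul_apply_of_disjoint h, extendOp_mul_apply_of_disjoint h.symm]
  have : (∀ i, i ∉ X → i ∉ Y → σ i = τ i) ↔ ∀ i, i ∉ Y → i ∉ X → σ i = τ i :=
    forall_congr' fun i => ⟨fun h a b => h b a, fun h a b => h b a⟩
  simp only [this, mul_comm]

/-- `B ↦ B ⊗ 1` is a homomorphism of star algebras, hence a contraction. -/
theorem norm_extendOp_le (B : Matrix (X → Fin 2) (X → Fin 2) ℂ) : ‖extendOp X B‖ ≤ ‖B‖ := by
  let φ : Matrix (X → Fin 2) (X → Fin 2) ℂ →⋆ₙₐ[ℂ] QubitOp N :=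
    { toFun := extendOp X
      map_smul' := fun c B => by
        ext σ τ
        simp only [extendOp, Matrix.smul_apply, MonoidHom.id_apply]
        split_ifs <;> simp
      map_zero' := by ext σ τ; simp [extendOp]
      map_add' := fun B C => by
        ext σ τ
        simp only [extendOp, Matrix.add_apply]
        split_ifs <;> simp
      map_mul' := extendOp_mul
      map_star' := extendOp_conjTranspose }
  exact NonUnitalStarAlgHom.norm_apply_le φ B

open scoped MatrixOrder in
/-- A positive operator on `X` has a root on `X` whose norm is controlled by the trace of its
restriction; unlike the norm, this trace is additive. -/
theorem ActsOn.exists_root {A : QubitOp N} (hA : ActsOn A X) (hpos : A.PosSemidef) :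
    ∃ C : Matrix (X → Fin 2) (X → Fin 2) ℂ, star (extendOp X C) * extendOp X C = A ∧
      ‖extendOp X C‖ ^ 2 ≤ RCLike.re (restrictOp X A).trace := by
  have hB : (restrictOp X A).PosSemidef := hpos.submatrix _
  obtain ⟨C, hC⟩ : ∃ C, restrictOp X A = star C * C :=
    CStarAlgebra.nonneg_iff_eq_star_mul_self.mp hB.nonneg
  refine ⟨C, ?_, ?_⟩
  · rw [Matrix.star_eq_conjTranspose, ← extendOp_conjTranspose, ← extendOp_mul,
      ← Matrix.star_eq_conjTranspose, ← hC, hA.extendOp_restrictOp]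
  · calc ‖extendOp X C‖ ^ 2 ≤ ‖C‖ ^ 2 := by gcongr; exact norm_extendOp_le C
      _ = ‖restrictOp X A‖ := by rw [hC, CStarRing.norm_star_mul_self, sq]
      _ ≤ _ := hB.norm_le_re_trace

theorem re_trace_restrictOp_le (A : QubitOp N) :
    RCLike.re (restrictOp X A).trace ≤ 2 ^ X.card * ‖A‖ := by
  rw [Matrix.trace, map_sum]
  calc _ ≤ ∑ _ρ : X → Fin 2, ‖A‖ := Finset.sum_le_sum fun ρ _ =>
        (RCLike.re_le_norm _).trans (norm_apply_le_l2_opNorm A _ _)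
    _ = 2 ^ X.card * ‖A‖ := by simp

end Locality

/-! ### Trotter error of a system of pieces -/

theorem norm_pow_sub_pow_mul_le {𝒜 : Type*} [NormedRing 𝒜] {U T Q : 𝒜} (hU : ‖U‖ ≤ 1)
    (hT : ‖T‖ ≤ 1) (hQ : Commute U Q) (r : ℕ) :
    ‖(U ^ r - T ^ r) * Q‖ ≤ r * ‖(U - T) * Q‖ := by
  induction r with
  | zero => simp
  | succ r ih =>
    have h1 : (U ^ (r + 1) - T ^ (r + 1)) * Q =
        (U - T) * Q * U ^ r + T * ((U ^ r - T ^ r) * Q) := by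
      have := (hQ.pow_left r).eq
      rw [mul_assoc (U - T), ← this, pow_succ', pow_succ']
      noncomm_ring
    rw [h1]
    rcases r with _ | r
    · simp
    have h2 : ‖U ^ (r + 1)‖ ≤ 1 :=
      (norm_pow_le' U r.succ_pos).trans (pow_le_one₀ (norm_nonneg _) hU)
    calc _ ≤ ‖(U - T) * Q‖ * ‖U ^ (r + 1)‖ + ‖T‖ * ‖(U ^ (r + 1) - T ^ (r + 1)) * Q‖ :=
          (norm_add_le _ _).trans (add_le_add (norm_mul_le _ _) (norm_mul_le _ _))
      _ ≤ ‖(U - T) * Q‖ * 1 + 1 * ((r + 1 : ℕ) * ‖(U - T) * Q‖) := by gcongr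
      _ = _ := by push_cast; ring

namespace PieceSystem

variable {S P : Type} [DecidableEq S] [Fintype P] [DecidableEq P] {𝓗 : Type}
  [NormedAddCommGroup 𝓗] [InnerProductSpace ℂ 𝓗] [CompleteSpace 𝓗] {k : ℕ}
  (𝒮 : PieceSystem S P 𝓗 k)

omit [DecidableEq P] in
theorem sum_norm_root_sq (ψ : 𝓗) :
    ((∑ p, ‖𝒮.root p ψ‖ ^ 2 : ℝ) : ℂ) = inner ℂ ψ ((∑ p, 𝒮.piece p) ψ) := by
  simp only [sum_apply, inner_sum, Complex.ofReal_sum]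
  refine Finset.sum_congr rfl fun p _ => ?_
  rw [piece, mul_apply_eq_comp, ContinuousLinearMap.star_eq_adjoint,
    ContinuousLinearMap.adjoint_inner_right, inner_self_eq_norm_sq_to_K]
  simp

omit [DecidableEq P] in
theorem sum_strength_le (l : List (ℝ × (P → ℂ))) {m G : ℝ} (hm : 0 ≤ m)
    (hρ : ∀ p, (l.map fun x => |x.1| * ‖x.2 p‖).sum ≤ m)
    (hG : ∀ i, ∑ p, (if i ∈ 𝒮.supp p then 𝒮.wt p else 0) ≤ G) (i : S) :
    (l.map fun x => |x.1| * 𝒮.strength x.2 i).sum ≤ m * G := by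
  have h1 : (l.map fun x => |x.1| * 𝒮.strength x.2 i).sum =
      ∑ p, (l.map fun x => |x.1| * ‖x.2 p‖).sum * (if i ∈ 𝒮.supp p then 𝒮.wt p else 0) := by
    clear hρ
    induction l with
    | nil => simp
    | cons x l ih =>
      simp only [List.map_cons, List.sum_cons, ih, add_mul, Finset.sum_add_distrib]
      rw [strength, Finset.mul_sum]
      congr 1
      refine Finset.sum_congr rfl fun p _ => ?_
      split_ifs <;> ring
  rw [h1]
  calc _ ≤ ∑ p, m * (if i ∈ 𝒮.supp p then 𝒮.wt p else 0) := by
        refine Finset.sum_le_sum fun p _ => mul_le_mul_of_nonneg_right (hρ p) ?_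
        split_ifs
        exacts [𝒮.wt_nonneg p, le_rfl]
    _ ≤ m * G := by
        rw [← Finset.mul_sum]
        exact mul_le_mul_of_nonneg_left (hG i) hm

/-- On low-energy vectors the effective generator is bounded by a multiple of `Δ + G`, uniformly in
the number of pieces, as long as `|z|` is small compared to `1 / G`. -/
theorem norm_effGen_mul_le (l : List (ℝ × (P → ℂ))) {m G Δ : ℝ} (hm : 0 ≤ m) (hG0 : 0 < G)
    (hΔ : 0 ≤ Δ)
    (hρ : ∀ p, (l.map fun x => |x.1| * ‖x.2 p‖).sum ≤ m)
    (hG : ∀ i, ∑ p, (if i ∈ 𝒮.supp p then 𝒮.wt p else 0) ≤ G) {Q : 𝓗 →L[ℂ] 𝓗}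
    (hQ : ‖Q‖ ≤ 1) (hHQ : ‖(∑ p, 𝒮.piece p) * Q‖ ≤ Δ) {z : ℂ}
    (hz : 6 * 3 ^ k * (k + 1) * m * G * ‖z‖ ≤ 1) :
    ‖effGen (l.map fun x => (x.1, 𝒮.combo x.2)) z * Q‖ ≤
      2 * 3 ^ k * m * (k + 1) * (Δ + G) := by
  have hs := 𝒮.sum_strength_le l hm hρ hG
  have hk : (0 : ℝ) ≤ k := Nat.cast_nonneg k
  set u : ℝ := 3 ^ k * m * G * ‖z‖ with hu
  have hu0 : 0 ≤ u := by positivity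
  have hz' : 6 * (k * u) + 6 * u ≤ 1 := by
    refine le_of_eq_of_le ?_ hz
    rw [hu]; ring
  have hku : 0 ≤ k * u := by positivity
  set β : ℝ := 2 * 3 ^ k * m with hβ
  have hβ0 : 0 ≤ β := by positivity
  have hM0 : 0 ≤ β * G := by positivity
  have hf : ∀ i, 6 * 3 ^ k * ‖z‖ * (l.map fun x => |x.1| * 𝒮.strength x.2 i).sum ≤ 1 := fun i =>
    calc _ ≤ 6 * 3 ^ k * ‖z‖ * (m * G) := by gcongr; exact hs i
      _ = 6 * u := by rw [hu]; ring
      _ ≤ 1 := by linarith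
  have hν : ∀ i, (3 ^ k + 2 * (3 ^ k * (k * (β * G))) * ‖z‖) *
      (l.map fun x => |x.1| * 𝒮.strength x.2 i).sum ≤ β * G := fun i =>
    calc _ ≤ (3 ^ k + 2 * (3 ^ k * (k * (β * G))) * ‖z‖) * (m * G) := by gcongr; exact hs i
      _ = 3 ^ k * m * G * (1 + 4 * (k * u) ) := by rw [hu, hβ]; ring
      _ ≤ 3 ^ k * m * G * 2 := by gcongr; linarith
      _ = β * G := by rw [hβ]; ring
  have hρ' : ∀ p, (3 ^ k + 3 ^ k * (k * (β * G)) * ‖z‖) *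
      (l.map fun x => |x.1| * ‖x.2 p‖).sum ≤ β := fun p =>
    calc _ ≤ (3 ^ k + 3 ^ k * (k * (β * G)) * ‖z‖) * m := by gcongr; exact hρ p
      _ = 3 ^ k * m * (1 + 2 * (k * u)) := by rw [hu, hβ]; ring
      _ ≤ 3 ^ k * m * 2 := by gcongr; linarith
      _ = β := by rw [hβ]; ring
  refine ContinuousLinearMap.opNorm_le_bound _ (by positivity) fun φ => ?_
  have key := 𝒮.norm_effGen_apply_sq_le l z hM0 hβ0 hG0.le hf hν hρ' hG (Q φ)
  have hψ : ‖Q φ‖ ≤ ‖φ‖ := (Q.le_of_opNorm_le hQ φ).trans (by simp)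
  have hHψ : ‖(∑ p, 𝒮.piece p) (Q φ)‖ ≤ Δ * ‖φ‖ :=
    ((∑ p, 𝒮.piece p) * Q).le_of_opNorm_le hHQ φ
  have hE : ∑ p, ‖𝒮.root p (Q φ)‖ ^ 2 ≤ Δ * ‖φ‖ ^ 2 := by
    have h1 := congrArg norm (𝒮.sum_norm_root_sq (Q φ))
    rw [Complex.norm_real, Real.norm_of_nonneg (by positivity)] at h1
    rw [h1]
    calc _ ≤ ‖Q φ‖ * ‖(∑ p, 𝒮.piece p) (Q φ)‖ := norm_inner_le_norm _ _
      _ ≤ ‖φ‖ * (Δ * ‖φ‖) := by gcongr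
      _ = _ := by ring
  rw [sum_apply] at hHψ
  refine le_of_sq_le_sq ?_ (by positivity)
  calc _ ≤ β ^ 2 * (Δ * ‖φ‖) ^ 2 + (β ^ 2 * (k * G) + β * G * β) * (Δ * ‖φ‖ ^ 2) := by
        refine key.trans ?_
        gcongr
    _ = β ^ 2 * ‖φ‖ ^ 2 * (Δ ^ 2 + (k + 1) * (G * Δ)) := by ring
    _ ≤ β ^ 2 * ‖φ‖ ^ 2 * ((k + 1) * (Δ + G)) ^ 2 := by
        gcongr
        have : 0 ≤ G * Δ := by positivity
        nlinarith [mul_nonneg hk this, mul_nonneg hk (sq_nonneg Δ), mul_nonneg hk (sq_nonneg G),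
          mul_nonneg (mul_nonneg hk hk) (sq_nonneg (Δ + G)), sq_nonneg G]
    _ = _ := by ring

/-- The error of `r` Trotter steps on the range of a spectral projection `Q` of `∑ p, h_p` for
energies at most `Δ`. -/
theorem norm_exp_sub_expProd_pow_mul_le (l : List (ℝ × (P → ℂ))) {m G Δ t : ℝ} {p r : ℕ}
    (hm : 0 ≤ m) (hG0 : 0 < G) (hΔ : 0 ≤ Δ) (hp : 1 ≤ p) (ht : 0 ≤ t) (hr : 1 ≤ r)
    (hsa : ∀ x ∈ l, IsSelfAdjoint (𝒮.combo x.2))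
    (hρ : ∀ p, (l.map fun x => |x.1| * ‖x.2 p‖).sum ≤ m)
    (hG : ∀ i, ∑ p, (if i ∈ 𝒮.supp p then 𝒮.wt p else 0) ≤ G) {H Q : 𝓗 →L[ℂ] 𝓗}
    (hH : H = ∑ p, 𝒮.piece p) (hcomm : Commute H Q) (hQ : ‖Q‖ ≤ 1) (hHQ : ‖H * Q‖ ≤ Δ)
    (horder : (fun t : ℝ => expProd (l.map fun x => (x.1, 𝒮.combo x.2)) t -
      NormedSpace.exp ((t : ℂ) • (-Complex.I • H))) =O[𝓝 0] fun t : ℝ => t ^ (p + 1))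
    (htr : 6 * 3 ^ k * (k + 1) * (m + 1) * G * t < r) :
    ‖(NormedSpace.exp ((t : ℂ) • (-Complex.I • H)) -
        expProd (l.map fun x => (x.1, 𝒮.combo x.2)) ((t / r : ℝ) : ℂ) ^ r) * Q‖ ≤
      t * (((2 * 3 ^ k * m + 1) * (k + 1)) * (Δ + G)) *
        (6 * 3 ^ k * (k + 1) * (m + 1) * G * t / r) ^ p := by
  let _ : NormedAlgebra ℚ (𝓗 →L[ℂ] 𝓗) := .restrictScalars ℚ ℂ _
  set A : ℝ := 6 * 3 ^ k * (k + 1) * (m + 1) * G with hA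
  have hA0 : 0 < A := by positivity
  have hr0 : (0 : ℝ) < r := by exact_mod_cast hr
  set s : ℝ := t / r with hs'
  have hs0 : 0 ≤ s := by positivity
  set L := l.map fun x => (x.1, 𝒮.combo x.2) with hL
  have hLsa : ∀ x ∈ L, IsSelfAdjoint x.2 := fun x hx => by
    obtain ⟨y, hy, rfl⟩ := List.mem_map.1 hx
    exact hsa y hy
  have hHsa : IsSelfAdjoint H := by
    rw [hH]
    exact isSelfAdjoint_sum _ fun p _ => IsSelfAdjoint.star_mul_self _
  set B : ℝ := ((2 * 3 ^ k * m + 1) * (k + 1)) * (Δ + G) with hB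
  have hB0 : 0 ≤ B := by positivity
  have hbound : ∀ z : ℂ, ‖z‖ < 1 / A → ‖(effGen L z - H) * Q‖ ≤ B := fun z hz => by
    have h1 : 6 * 3 ^ k * (k + 1) * m * G * ‖z‖ ≤ 1 := by
      rw [lt_div_iff₀ hA0] at hz
      have : 6 * 3 ^ k * (k + 1) * m * G * ‖z‖ ≤ ‖z‖ * A := by
        rw [hA, mul_comm ‖z‖]
        gcongr
        linarith
      linarith
    have h2 := 𝒮.norm_effGen_mul_le l hm hG0 hΔ hρ hG hQ (hH ▸ hHQ) h1
    rw [sub_mul]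
    refine (norm_sub_le _ _).trans ((add_le_add h2 hHQ).trans ?_)
    have h4 : 0 ≤ (k : ℝ) * (Δ + G) := by positivity
    rw [hB]
    nlinarith
  have hsA : s < 1 / A := by
    rw [lt_div_iff₀ hA0, hs', div_mul_eq_mul_div, div_lt_one hr0, mul_comm]
    exact htr
  have hD : ∀ τ : ℝ, 0 ≤ τ → τ < s → ‖(effGen L (τ : ℂ) - H) * Q‖ ≤ B * (A * s) ^ p :=
    fun τ hτ hτs => by
      have hn : ‖(τ : ℂ)‖ = τ := by simp [abs_of_nonneg hτ]
      refine (norm_effGen_sub_mul_le L H Q hp (effGen_sub_isBigO L H horder) hbound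
        (by rw [hn]; exact hτs.trans hsA)).trans ?_
      rw [hn, div_div_eq_mul_div, div_one, mul_comm τ]
      gcongr
  have h1 := norm_exp_sub_expProd_mul_le L hLsa hHsa hcomm hs0 hD
  have hU : ‖NormedSpace.exp ((s : ℂ) • (-Complex.I • H))‖ ≤ 1 := by
    have := expProd_mem_unitary [((1 : ℝ), H)] (by simpa using hHsa) s
    simp only [expProd, List.map_cons, List.map_nil, List.prod_cons, List.prod_nil,
      Complex.ofReal_one, mul_one] at this
    exact norm_le_one_of_star_mul_self this.1
  have hT : ‖expProd L (s : ℂ)‖ ≤ 1 :=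
    norm_le_one_of_star_mul_self (expProd_mem_unitary L hLsa s).1
  have hUQ : Commute (NormedSpace.exp ((s : ℂ) • (-Complex.I • H))) Q :=
    ((hcomm.smul_left _).smul_left _).exp_left
  have hpow : NormedSpace.exp ((t : ℂ) • (-Complex.I • H)) =
      NormedSpace.exp ((s : ℂ) • (-Complex.I • H)) ^ r := by
    have h2 : (t : ℂ) = r * (s : ℂ) := by
      rw [hs']
      push_cast
      field_simp
    rw [← NormedSpace.exp_nsmul, ← Nat.cast_smul_eq_nsmul ℂ, h2, mul_smul]
  rw [hpow]
  refine (norm_pow_sub_pow_mul_le hU hT hUQ r).trans ?_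
  calc (r : ℝ) * _ ≤ r * (s * (B * (A * s) ^ p)) := by gcongr
    _ = t * B * (A * t / r) ^ p := by
      rw [hs', mul_div_assoc A]
      field_simp

end PieceSystem

/-! ### Spectral projections -/

section Spectral

variable {N : ℕ} {H : QubitOp N} (hH : H.IsHermitian)

/-- The operator with the eigenvectors of `H` and the eigenvalues `d`. -/
noncomputable def spectralOp (d : (Fin N → Fin 2) → ℂ) : QubitOp N :=
  (hH.eigenvectorUnitary : QubitOp N) * Matrix.diagonal d *
    star (hH.eigenvectorUnitary : QubitOp N)

theorem spectralOp_mul (d d' : (Fin N → Fin 2) → ℂ) :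
    spectralOp hH d * spectralOp hH d' = spectralOp hH (d * d') := by
  have h : star (hH.eigenvectorUnitary : QubitOp N) * (hH.eigenvectorUnitary : QubitOp N) = 1 :=
    Unitary.coe_star_mul_self _
  have h2 : Matrix.diagonal (d * d') = (Matrix.diagonal d * Matrix.diagonal d' : QubitOp N) := by
    rw [Matrix.diagonal_mul_diagonal]; rfl
  rw [spectralOp, spectralOp, spectralOp, h2]
  calc _ = (hH.eigenvectorUnitary : QubitOp N) * Matrix.diagonal d *
        (star (hH.eigenvectorUnitary : QubitOp N) * (hH.eigenvectorUnitary : QubitOp N)) *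
          Matrix.diagonal d' * star (hH.eigenvectorUnitary : QubitOp N) := by
        simp only [mul_assoc]
    _ = _ := by rw [h, mul_one]; simp only [mul_assoc]

theorem norm_spectralOp (d : (Fin N → Fin 2) → ℂ) : ‖spectralOp hH d‖ = ‖d‖ := by
  rw [spectralOp, ← Unitary.coe_star, CStarRing.norm_mul_coe_unitary,
    CStarRing.norm_coe_unitary_mul, Matrix.l2_opNorm_diagonal]

theorem eq_spectralOp : H = spectralOp hH fun n => (hH.eigenvalues n : ℂ) := by
  have h := hH.spectral_theorem
  rw [Unitary.conjStarAlgAut_apply] at h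
  exact h

theorem commute_lowEnergyProj (Δ : ℝ) : Commute H (lowEnergyProj hH Δ) := by
  have h := eq_spectralOp hH
  have h2 : lowEnergyProj hH Δ =
    spectralOp hH fun n => if hH.eigenvalues n ≤ Δ then (1 : ℂ) else 0 := rfl
  have h3 := spectralOp_mul hH (fun n => (hH.eigenvalues n : ℂ))
    fun n => if hH.eigenvalues n ≤ Δ then (1 : ℂ) else 0
  have h4 := spectralOp_mul hH (fun n => if hH.eigenvalues n ≤ Δ then (1 : ℂ) else 0)
    fun n => (hH.eigenvalues n : ℂ)
  rw [mul_comm, ← h3, ← h2, ← h] at h4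
  exact h4.symm

theorem norm_lowEnergyProj_le (Δ : ℝ) : ‖lowEnergyProj hH Δ‖ ≤ 1 := by
  refine (norm_spectralOp hH _).trans_le ((pi_norm_le_iff_of_nonneg zero_le_one).2 fun n => ?_)
  split_ifs <;> simp

theorem norm_mul_lowEnergyProj_le (hpos : H.PosSemidef) {Δ : ℝ} (hΔ : 0 ≤ Δ) :
    ‖H * lowEnergyProj hH Δ‖ ≤ Δ := by
  have h3 := spectralOp_mul hH (fun n => (hH.eigenvalues n : ℂ))
    fun n => if hH.eigenvalues n ≤ Δ then (1 : ℂ) else 0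
  rw [← eq_spectralOp hH] at h3
  refine (congrArg norm h3).trans_le ((norm_spectralOp hH _).trans_le
    ((pi_norm_le_iff_of_nonneg hΔ).2 fun n => ?_))
  have h0 : 0 ≤ hH.eigenvalues n := hpos.eigenvalues_nonneg n
  simp only [Pi.mul_apply]
  split_ifs with h
  · simpa [abs_of_nonneg h0] using h
  · simpa using hΔ

end Spectral

/-! ### The system of pieces of a partition -/

/-- The star algebra isomorphism between matrices and operators on `ℂ^(2^N)`. -/
noncomputable abbrev toOp (N : ℕ) :
    QubitOp N ≃⋆ₐ[ℂ] (EuclideanSpace ℂ (Fin N → Fin 2) →L[ℂ] EuclideanSpace ℂ (Fin N → Fin 2)) :=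
  Matrix.toEuclideanCLM (n := Fin N → Fin 2) (𝕜 := ℂ)

theorem norm_toOp {N : ℕ} (A : QubitOp N) : ‖toOp N A‖ = ‖A‖ :=
  Matrix.l2_opNorm_toEuclideanCLM A

theorem toOp_exp {N : ℕ} (A : QubitOp N) :
    toOp N (NormedSpace.exp A) = NormedSpace.exp (toOp N A) := by
  let _ : NormedAlgebra ℚ (QubitOp N) := .restrictScalars ℚ ℂ _
  refine NormedSpace.map_exp (toOp N) ?_ A
  exact (AddMonoidHomClass.isometry_of_norm (toOp N) norm_toOp).continuous

theorem toOp_evolution {N : ℕ} (A : QubitOp N) (t : ℝ) :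
    toOp N (evolution A t) = NormedSpace.exp ((t : ℂ) • (-Complex.I • toOp N A)) := by
  rw [evolution, toOp_exp, map_smul, smul_smul]
  congr 2
  ring

namespace LocalHamiltonian.Partition

variable {N k Γ : ℕ} {g : ℝ} {h : LocalHamiltonian N k g} (D : h.Partition Γ)

/-- The terms `h_X` on more than `k` sites vanish, and by positivity so do their parts. -/
theorem part_eq_zero_of_card (γ : Fin Γ) {X : Finset (Fin N)} (hX : k < X.card) :
    D.part γ X = 0 := by
  have h1 : ∑ γ, RCLike.re (D.part γ X).trace = 0 := by
    rw [← map_sum, ← Matrix.trace_sum, D.sum_part, h.eq_zero_of_card X hX]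
    simp
  have h2 : ∀ γ, ‖D.part γ X‖ ≤ RCLike.re (D.part γ X).trace := fun γ =>
    (D.posSemidef γ X).norm_le_re_trace
  have h3 : RCLike.re (D.part γ X).trace ≤ ∑ γ, RCLike.re (D.part γ X).trace :=
    Finset.single_le_sum (f := fun γ => RCLike.re (D.part γ X).trace)
      (fun γ _ => (norm_nonneg _).trans (h2 γ)) (Finset.mem_univ γ)
  exact norm_le_zero_iff.1 (((h2 γ).trans h3).trans h1.le)

/-- A local root of `h_X^γ`. -/
noncomputable def localRoot (γ : Fin Γ) (X : Finset (Fin N)) :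
    Matrix (X → Fin 2) (X → Fin 2) ℂ :=
  ((D.actsOn γ X).exists_root (D.posSemidef γ X)).choose

theorem star_mul_localRoot (γ : Fin Γ) (X : Finset (Fin N)) :
    star (extendOp X (D.localRoot γ X)) * extendOp X (D.localRoot γ X) = D.part γ X :=
  ((D.actsOn γ X).exists_root (D.posSemidef γ X)).choose_spec.1

theorem norm_localRoot_sq_le (γ : Fin Γ) (X : Finset (Fin N)) :
    ‖extendOp X (D.localRoot γ X)‖ ^ 2 ≤ RCLike.re (restrictOp X (D.part γ X)).trace :=
  ((D.actsOn γ X).exists_root (D.posSemidef γ X)).choose_spec.2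

/-- The terms `h_X^γ` with at most `k` sites, as a system of pieces. -/
noncomputable def pieces : PieceSystem (Fin N) (Fin Γ × {X : Finset (Fin N) // X.card ≤ k})
    (EuclideanSpace ℂ (Fin N → Fin 2)) k where
  supp p := p.2
  root p := toOp N (extendOp p.2 (D.localRoot p.1 p.2))
  -- The trace rather than the norm, so that the weights of the parts of one term can be summed.
  wt p := RCLike.re (restrictOp p.2 (D.part p.1 p.2)).trace
  card_supp_le p := p.2.2
  norm_root_sq_le p := by
    rw [norm_toOp]
    exact D.norm_localRoot_sq_le p.1 p.2
  commute_root p q hpq := (commute_extendOp_of_disjoint hpq _ _).map (toOp N)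
  commute_star_root p q hpq := by
    rw [← map_star, Matrix.star_eq_conjTranspose, ← extendOp_conjTranspose]
    exact (commute_extendOp_of_disjoint hpq _ _).map (toOp N)

theorem piece_pieces (p : Fin Γ × {X : Finset (Fin N) // X.card ≤ k}) :
    D.pieces.piece p = toOp N (D.part p.1 p.2) := by
  rw [PieceSystem.piece, ← D.star_mul_localRoot p.1 p.2, map_mul, map_star]
  rfl

/-- Extensivity of the pieces, with the same constant for any number of groups: the traces of the
parts `h_X^γ` add up to the trace of `h_X`, which is at most `2 ^ k ‖h_X‖`. -/
theorem sum_wt_pieces_le (i : Fin N) :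
    ∑ p, (if i ∈ D.pieces.supp p then D.pieces.wt p else 0) ≤ 2 ^ k * g := by
  have h1 : ∀ X : {X : Finset (Fin N) // X.card ≤ k},
      ∑ γ, (if i ∈ X.1 then D.pieces.wt (γ, X) else 0) ≤
        if i ∈ X.1 then 2 ^ k * ‖h.term X‖ else 0 := fun X => by
    split_ifs
    · have h2 : ∑ γ, D.pieces.wt (γ, X) = RCLike.re (restrictOp X.1 (h.term X)).trace := by
        have h3 : restrictOp X.1 (h.term X) = ∑ γ, restrictOp X.1 (D.part γ X) := by
          rw [← D.sum_part]
          ext ρ ρ'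
          simp [restrictOp, Matrix.sum_apply]
        rw [h3, Matrix.trace_sum, map_sum]
        rfl
      rw [h2]
      refine (re_trace_restrictOp_le _).trans ?_
      gcongr
      · norm_num
      · exact X.2
    · simp
  rw [Fintype.sum_prod_type_right]
  refine (Finset.sum_le_sum fun X _ => h1 X).trans ?_
  calc _ ≤ ∑ X : Finset (Fin N), (if i ∈ X then 2 ^ k * ‖h.term X‖ else 0) := by
        rw [← Finset.sum_subtype (Finset.univ.filter fun X : Finset (Fin N) => X.card ≤ k)
          (by simp) fun X => if i ∈ X then 2 ^ k * ‖h.term X‖ else 0]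
        refine Finset.sum_le_sum_of_subset_of_nonneg (Finset.filter_subset _ _) fun X _ _ => ?_
        positivity
    _ = 2 ^ k * ∑ X with i ∈ X, ‖h.term X‖ := by
        rw [Finset.sum_filter, Finset.mul_sum]
        refine Finset.sum_congr rfl fun X _ => ?_
        split_ifs <;> simp
    _ ≤ _ := by
        gcongr
        exact h.extensive i

theorem sum_pieces_group (γ : Fin Γ) :
    ∑ X : {X : Finset (Fin N) // X.card ≤ k}, toOp N (D.part γ X) = toOp N (D.group γ) := by
  rw [group, map_sum, ← Finset.sum_subtype
    (Finset.univ.filter fun X : Finset (Fin N) => X.card ≤ k) (by simp)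
    fun X => toOp N (D.part γ X)]
  refine Finset.sum_subset (Finset.filter_subset _ _) fun X _ hX => ?_
  rw [D.part_eq_zero_of_card γ (by simpa using hX), map_zero]

theorem sum_piece_pieces : ∑ p, D.pieces.piece p = toOp N h.total := by
  have h1 : h.total = ∑ γ, D.group γ := by
    simp only [total, group, ← D.sum_part]
    exact Finset.sum_comm
  rw [h1, map_sum, Fintype.sum_prod_type]
  refine Finset.sum_congr rfl fun γ _ => ?_
  simp only [piece_pieces]
  exact D.sum_pieces_group γ

theorem combo_pieces (γ : Fin Γ) :
    D.pieces.combo (fun p => if p.1 = γ then 1 else 0) = toOp N (D.group γ) := by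
  rw [PieceSystem.combo, Fintype.sum_prod_type, Finset.sum_eq_single γ]
  · simp only [if_true, one_smul, piece_pieces]
    exact D.sum_pieces_group γ
  · intro γ' _ hne
    simp [hne]
  · simp

end LocalHamiltonian.Partition

/-! ### The error of a product formula on low-energy states -/

namespace ProductFormula

variable {N k Γ c p : ℕ} {g : ℝ} {h : LocalHamiltonian N k g} {D : h.Partition Γ}
  (T : ProductFormula D c p)

/-- The factors of a product formula: pairs of a coefficient `α_v` and the indicator of the pieces
that belong to the group `γ_v`. -/
noncomputable def factors : List (ℝ × (Fin Γ × {X : Finset (Fin N) // X.card ≤ k} → ℂ)) :=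
  List.ofFn fun v => (T.coeff v, fun q => if q.1 = T.idx v then 1 else 0)

theorem toOp_step (s : ℝ) : toOp N (T.step s) =
    expProd (T.factors.map fun x => (x.1, D.pieces.combo x.2)) (s : ℂ) := by
  rw [step, map_list_prod, expProd, factors, List.map_ofFn, List.map_ofFn, List.map_ofFn]
  congr 2
  ext1 v
  simp only [Function.comp_apply, D.combo_pieces, toOp_evolution, smul_smul]
  congr 2
  push_cast
  ring

theorem sum_factors_le {m : ℕ} (hm : ∀ γ, (Finset.univ.filter fun v => T.idx v = γ).card ≤ m)
    (q : Fin Γ × {X : Finset (Fin N) // X.card ≤ k}) :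
    (T.factors.map fun x => |x.1| * ‖x.2 q‖).sum ≤ m := by
  rw [factors, List.map_ofFn, List.sum_ofFn]
  calc _ ≤ ∑ v, (if T.idx v = q.1 then (1 : ℝ) else 0) := by
        refine Finset.sum_le_sum fun v _ => ?_
        simp only [Function.comp_apply, eq_comm (a := q.1)]
        split_ifs
        · simpa using T.abs_coeff_le_one v
        · simp
    _ = (Finset.univ.filter fun v => T.idx v = q.1).card := by simp
    _ ≤ m := by exact_mod_cast hm q.1

/-- The error of `r` Trotter steps.  Here `G` may be any bound for the extensivity constant `g`, and
`m` bounds the number of factors belonging to one group; the number of groups plays no role. -/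
theorem lowEnergyError_le {m : ℕ}
    (hm : ∀ γ, (Finset.univ.filter fun v => T.idx v = γ).card ≤ m) (hp : 1 ≤ p) {G Δ t : ℝ}
    (hG : g ≤ G) (hG0 : 0 < G) (hΔ : 0 ≤ Δ) (ht : 0 ≤ t) {r : ℕ} (hr : 1 ≤ r)
    (htr : 6 * 3 ^ k * (k + 1) * (m + 1) * (2 ^ k * G) * t < r) :
    T.lowEnergyError Δ t r ≤ t * (((2 * 3 ^ k * m + 1) * (k + 1)) * (Δ + 2 ^ k * G)) *
      (6 * 3 ^ k * (k + 1) * (m + 1) * (2 ^ k * G) * t / r) ^ p := by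
  have hsa : ∀ x ∈ T.factors, IsSelfAdjoint (D.pieces.combo x.2) := fun x hx => by
    obtain ⟨v, rfl⟩ := (List.mem_ofFn' _ _).1 hx
    rw [D.combo_pieces]
    refine IsSelfAdjoint.map ?_ (toOp N)
    exact isSelfAdjoint_sum _ fun X _ => (D.posSemidef _ X).isHermitian
  have horder : (fun t : ℝ => expProd (T.factors.map fun x => (x.1, D.pieces.combo x.2)) t -
      NormedSpace.exp ((t : ℂ) • (-Complex.I • toOp N h.total))) =O[𝓝 0]
        fun t : ℝ => t ^ (p + 1) := by
    refine IsBigO.congr_left (f₁ := fun t : ℝ => toOp N (T.step t - evolution h.total t)) ?_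
      fun t => by rw [map_sub, toOp_step, toOp_evolution]
    refine IsBigO.trans (IsBigO.of_bound 1 (.of_forall fun t => ?_)) T.order_condition
    rw [norm_toOp, one_mul]
    rfl
  have hpos : h.total.PosSemidef := Matrix.posSemidef_sum _ fun X _ => h.posSemidef X
  have key := D.pieces.norm_exp_sub_expProd_pow_mul_le T.factors (m := m) (G := 2 ^ k * G) (Δ := Δ)
    (t := t) (p := p) (r := r) (Nat.cast_nonneg m) (by positivity) hΔ hp ht hr hsa
    (T.sum_factors_le hm)
    (fun i => (D.sum_wt_pieces_le i).trans (by gcongr))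
    (H := toOp N h.total) (Q := toOp N (lowEnergyProj h.isHermitian_total Δ))
    D.sum_piece_pieces.symm ((commute_lowEnergyProj h.isHermitian_total Δ).map (toOp N))
    ((norm_toOp _).trans_le (norm_lowEnergyProj_le _ Δ))
    (by rw [← map_mul, norm_toOp]; exact norm_mul_lowEnergyProj_le _ hpos hΔ) horder htr
  rw [← toOp_step, ← toOp_evolution, ← map_pow, ← map_sub, ← map_mul, norm_toOp] at key
  exact key

end ProductFormula

/-! ### Choice of the Trotter number -/

/-- An error bound of the form `t E (Δ + g) (A g t / r) ^ p`, valid for `A g t < r`, is met by a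
Trotter number of the claimed size. -/
theorem exists_trotter_number {A E : ℝ} (hA : 0 < A) (hAE : A ≤ E) {p N : ℕ} (hp : 1 ≤ p)
    (hN : 2 ≤ N) {g t Δ ε : ℝ} (hg : 0 < g) (ht : 0 ≤ t) (hΔ : 0 ≤ Δ) (hε : 0 < ε) (hε1 : ε < 1) :
    ∃ r : ℕ, 1 ≤ r ∧
      (r : ℝ) ≤ max 1 (2 * A * (E / Real.log 2) ^ (1 / (p : ℝ)) * trotterScale p N g t Δ ε) ∧
      A * g * t < r ∧ t * (E * (Δ + g)) * (A * g * t / r) ^ p ≤ ε := by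
  set q : ℝ := 1 / (p : ℝ) with hq
  set L : ℝ := Real.log (N / ε) with hL
  set l2 : ℝ := Real.log 2 with hl2
  have hl0 : 0 < l2 := Real.log_pos one_lt_two
  have hl1 : l2 ≤ 1 := by have := Real.log_two_lt_d9; linarith
  have hLl : l2 ≤ L := by
    refine Real.log_le_log two_pos ?_
    rw [le_div_iff₀ hε]
    have : (2 : ℝ) ≤ N := by exact_mod_cast hN
    nlinarith
  set x : ℝ := g * t with hx
  have hx0 : 0 ≤ x := by positivity
  set y : ℝ := (Δ * t + x * L) / ε with hy
  have hL0 : 0 ≤ L := hl0.le.trans hLl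
  have hy0 : 0 ≤ y := by positivity
  have hE : 0 < E := hA.trans_le hAE
  set Y : ℝ := E / l2 * y with hY
  have hY0 : 0 ≤ Y := by positivity
  have hq0 : 0 < q := by positivity
  -- The first entry of the maximum ensures `A g t < r`, the second one the error bound.
  set w : ℝ := A * x * max 1 (Y ^ q) with hw
  have hw0 : 0 ≤ w := by positivity
  have hscale : trotterScale p N g t Δ ε = x * y ^ q := rfl
  -- The first entry of the maximum is never the decisive one once `w ≥ 1`.
  have hw1 : 1 ≤ w → w = A * x * Y ^ q := fun h1 => by
    rw [hw]
    congr 1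
    refine max_eq_right ?_
    by_contra hlt
    rw [not_le] at hlt
    rw [hw, max_eq_left hlt.le, mul_one] at h1
    have hY1 : 1 ≤ Y := by
      have h2 : x * l2 ≤ y := by
        rw [hy, le_div_iff₀ hε]
        have h3 : x * l2 * ε ≤ x * l2 := mul_le_of_le_one_right (by positivity) hε1.le
        have h4 : x * l2 ≤ x * L := by gcongr
        have h5 : 0 ≤ Δ * t := by positivity
        linarith
      calc 1 ≤ A * x := h1
        _ ≤ E * x := by gcongr
        _ = E / l2 * (x * l2) := by field_simp
        _ ≤ Y := by rw [hY]; gcongr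
    exact absurd (Real.one_le_rpow hY1 hq0.le) (not_le.2 hlt)
  set r : ℕ := ⌊w⌋₊ + 1 with hr
  have hr0 : (0 : ℝ) < r := by positivity
  have hwr : w < r := by rw [hr]; exact_mod_cast Nat.lt_floor_add_one w
  have hAr : A * x < r := by
    refine lt_of_le_of_lt ?_ hwr
    exact le_mul_of_one_le_right (by positivity) (le_max_left _ _)
  refine ⟨r, Nat.le_add_left 1 _, ?_, by rw [mul_assoc]; exact hAr, ?_⟩
  · rcases lt_or_ge w 1 with h1 | h1
    · refine le_max_of_le_left ?_
      rw [hr, Nat.floor_eq_zero.2 h1]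
      simp
    · refine le_max_of_le_right ?_
      have h2 : (r : ℝ) ≤ w + 1 := by
        rw [hr]; push_cast
        have := Nat.floor_le hw0
        linarith
      calc (r : ℝ) ≤ 2 * w := by linarith
        _ = _ := by
          rw [hw1 h1, hscale, hY, Real.mul_rpow (by positivity) hy0]
          ring
  · have hle : (A * g * t / r) ^ p * Y ≤ 1 := by
      have h1 : Y = (Y ^ q) ^ p := by
        rw [hq, one_div, Real.rpow_inv_natCast_pow hY0 (by omega)]
      rw [h1, ← mul_pow]
      refine pow_le_one₀ (by positivity) ?_
      rw [div_mul_eq_mul_div, div_le_one hr0, mul_assoc A]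
      refine le_trans ?_ hwr.le
      rw [hw]
      gcongr
      exact le_max_right _ _
    have h2 : t * (Δ + g) ≤ y * ε / l2 := by
      rw [le_div_iff₀ hl0, hy, div_mul_cancel₀ _ hε.ne']
      have h3 : x * l2 ≤ x * L := by gcongr
      have h4 : Δ * t * l2 ≤ Δ * t := mul_le_of_le_one_right (by positivity) hl1
      calc t * (Δ + g) * l2 = Δ * t * l2 + x * l2 := by rw [hx]; ring
        _ ≤ _ := by linarith
    calc _ = E * (t * (Δ + g)) * (A * g * t / r) ^ p := by ring
      _ ≤ E * (y * ε / l2) * (A * g * t / r) ^ p := by gcongr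
      _ = ε * ((A * g * t / r) ^ p * Y) := by rw [hY]; ring
      _ ≤ ε * 1 := by gcongr
      _ = ε := mul_one ε

/-- A single step has arbitrarily small error if the extensivity constant is small enough. -/
theorem exists_pos_trotter_error_le (A E : ℝ) {p : ℕ} (hp : 1 ≤ p) (t Δ : ℝ) {ε : ℝ} (hε : 0 < ε) :
    ∃ G : ℝ, 0 < G ∧ A * G * t < 1 ∧ t * (E * (Δ + G)) * (A * G * t) ^ p ≤ ε := by
  have h1 : Tendsto (fun G : ℝ => A * G * t) (𝓝[>] 0) (𝓝 0) :=
    (Continuous.tendsto' (by fun_prop) 0 0 (by simp)).mono_left nhdsWithin_le_nhds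
  have h2 : Tendsto (fun G : ℝ => t * (E * (Δ + G)) * (A * G * t) ^ p) (𝓝[>] 0) (𝓝 0) :=
    (Continuous.tendsto' (by fun_prop) 0 0
      (by simp [Nat.one_le_iff_ne_zero.1 hp])).mono_left nhdsWithin_le_nhds
  obtain ⟨G, hG0, hG1, hG2⟩ := ((eventually_mem_nhdsWithin).and
    ((h1.eventually_lt_const one_pos).and (h2.eventually_le_const hε))).exists
  exact ⟨G, hG0, hG1, hG2⟩

theorem LocalHamiltonian.nonneg {N k : ℕ} {g : ℝ} (h : LocalHamiltonian N k g) (hN : 2 ≤ N) :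
    0 ≤ g :=
  (Finset.sum_nonneg fun X _ => norm_nonneg (h.term X)).trans (h.extensive ⟨0, by omega⟩)

/-- The Trotter number in terms of a bound `m` for the number of factors belonging to one group. -/
theorem exists_trotter_number_of_card_le (p k m : ℕ) (hp : 1 ≤ p) :
    ∃ C : ℝ, 0 < C ∧ ∀ (c N Γ : ℕ) (g t Δ ε : ℝ), 2 ≤ N → 0 ≤ t → 0 ≤ Δ → 0 < ε → ε < 1 →
      ∀ (h : LocalHamiltonian N k g) (D : h.Partition Γ) (T : ProductFormula D c p),
        (∀ γ, (Finset.univ.filter fun v => T.idx v = γ).card ≤ m) →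
        ∃ r : ℕ, 1 ≤ r ∧ (r : ℝ) ≤ max 1 (C * trotterScale p N g t Δ ε) ∧
          T.lowEnergyError Δ t r ≤ ε := by
  set A : ℝ := 6 * 3 ^ k * (k + 1) * (m + 1) * 2 ^ k with hA
  have hA0 : 0 < A := by positivity
  set E : ℝ := A + (2 * 3 ^ k * m + 1) * (k + 1) * 2 ^ k with hE
  have hl0 : 0 < Real.log 2 := Real.log_pos one_lt_two
  refine ⟨2 * A * (E / Real.log 2) ^ (1 / (p : ℝ)), by positivity, ?_⟩
  intro c N Γ g t Δ ε hN ht hΔ hε hε1 h D T hm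
  have herr : ∀ G : ℝ, g ≤ G → 0 < G → ∀ r : ℕ, 1 ≤ r → A * G * t < r →
      T.lowEnergyError Δ t r ≤ t * (E * (Δ + G)) * (A * G * t / r) ^ p := by
    intro G hG hG0 r hr htr
    have hAG : 6 * 3 ^ k * (k + 1) * (m + 1) * (2 ^ k * G) * t = A * G * t := by rw [hA]; ring
    have h1 := T.lowEnergyError_le hm hp hG hG0 hΔ ht hr (by rw [hAG]; exact htr)
    rw [hAG] at h1
    refine h1.trans ?_
    gcongr t * ?_ * _
    have h2 : (1 : ℝ) ≤ 2 ^ k := one_le_pow₀ one_le_two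
    calc _ ≤ ((2 * 3 ^ k * m + 1) * (k + 1)) * (2 ^ k * Δ + 2 ^ k * G) := by
          gcongr
          exact le_mul_of_one_le_left hΔ h2
      _ = (2 * 3 ^ k * m + 1) * (k + 1) * 2 ^ k * (Δ + G) := by ring
      _ ≤ E * (Δ + G) := by
          gcongr
          rw [hE]
          linarith
  rcases (h.nonneg hN).eq_or_lt with hg | hg
  · -- For `g = 0` the scale vanishes, and a single step is good enough: the bound holds for every
    -- extensivity constant `G > 0`.
    obtain ⟨G, hG0, hG1, hG2⟩ := exists_pos_trotter_error_le A E hp t Δ hε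
    refine ⟨1, le_rfl, by simp, (herr G (hg ▸ hG0.le) hG0 1 le_rfl (by simpa using hG1)).trans ?_⟩
    simpa using hG2
  · obtain ⟨r, hr1, hr2, hr3, hr4⟩ := exists_trotter_number hA0
      (show A ≤ E by rw [hE]; exact le_add_of_nonneg_right (by positivity)) hp hN hg ht hΔ hε hε1
    exact ⟨r, hr1, hr2, (herr g le_rfl hg r hr1 hr3).trans hr4⟩

theorem mainTheorem3 (p k c a : ℕ) (hp : 1 ≤ p) (K : ℝ) :
    (∀ Γ₀ : ℕ, ∃ C : ℝ, 0 < C ∧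
      ∀ (N Γ : ℕ) (g t Δ ε : ℝ), 2 ≤ N → Γ ≤ Γ₀ → 0 ≤ t → 0 ≤ Δ → 0 < ε → ε < 1 →
        g * t ≤ K * (N : ℝ) ^ a → 1 / ε ≤ K * (N : ℝ) ^ a →
        ∀ (h : LocalHamiltonian N k g) (D : h.Partition Γ) (T : ProductFormula D c p),
          ∃ r : ℕ, 1 ≤ r ∧ (r : ℝ) ≤ max 1 (C * trotterScale p N g t Δ ε) ∧
            T.lowEnergyError Δ t r ≤ ε) ∧
    (∃ C : ℝ, 0 < C ∧
      ∀ (N Γ : ℕ) (g t Δ ε : ℝ), 2 ≤ N → 0 ≤ t → 0 ≤ Δ → 0 < ε → ε < 1 →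
        g * t ≤ K * (N : ℝ) ^ a → 1 / ε ≤ K * (N : ℝ) ^ a →
        ∀ (h : LocalHamiltonian N k g) (D : h.Partition Γ) (T : ProductFormula D c p),
          T.Balanced →
          ∃ r : ℕ, 1 ≤ r ∧
            (r : ℝ) ≤ max 1 (C * (trotterScale p N g t Δ ε * Real.log (N / ε))) ∧
            T.lowEnergyError Δ t r ≤ ε) := by
  constructor
  · intro Γ₀
    obtain ⟨C, hC, H⟩ := exists_trotter_number_of_card_le p k (c * Γ₀) hp
    refine ⟨C, hC, fun N Γ g t Δ ε hN hΓ ht hΔ hε hε1 _ _ h D T =>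
      H c N Γ g t Δ ε hN ht hΔ hε hε1 h D T fun γ => ?_⟩
    calc _ ≤ (Finset.univ : Finset (Fin (c * Γ))).card := Finset.card_filter_le _ _
      _ = c * Γ := by simp
      _ ≤ c * Γ₀ := Nat.mul_le_mul_left c hΓ
  · obtain ⟨C, hC, H⟩ := exists_trotter_number_of_card_le p k c hp
    have hl0 : 0 < Real.log 2 := Real.log_pos one_lt_two
    refine ⟨C / Real.log 2, by positivity, fun N Γ g t Δ ε hN ht hΔ hε hε1 _ _ h D T hT => ?_⟩
    obtain ⟨r, hr1, hr2, hr3⟩ := H c N Γ g t Δ ε hN ht hΔ hε hε1 h D T fun γ => (hT γ).le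
    refine ⟨r, hr1, hr2.trans (max_le_max le_rfl ?_), hr3⟩
    have hg := h.nonneg hN
    have hL : Real.log 2 ≤ Real.log (N / ε) := by
      refine Real.log_le_log two_pos ?_
      rw [le_div_iff₀ hε]
      have : (2 : ℝ) ≤ N := by exact_mod_cast hN
      nlinarith
    have hL0 : 0 ≤ Real.log (N / ε) := hl0.le.trans hL
    have hs : 0 ≤ trotterScale p N g t Δ ε := by
      rw [trotterScale]
      positivity
    -- The bound holds even without the last logarithm, which is at least `log 2`.
    calc C * trotterScale p N g t Δ ε
        = C / Real.log 2 * (trotterScale p N g t Δ ε * Real.log 2) := by field_simp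
      _ ≤ _ := by gcongr
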